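/- Let $\mathbb K\in\{\mathbb R,\mathbb C\}$, let $\mathcal H$ be a separable Hilbert space over $\mathbb K$ (inner product linear in the first argument) and let $\mathbb K^m$, $m\ge 1$, carry an arbitrary norm. **Setting.** Let $\mathcal A:D(\mathcal A)\subset\mathcal H\to\mathcal H$ and $\mathcal B:D(\mathcal B)\subset\mathcal H\to\mathbb K^m$ be linear with $D(\mathcal A)\subset D(\mathcal B)$, and assume that $(\mathcal A,\mathcal B)$ is a Riesz-spectral boundary control system, i.e.: 1. $\mathcal A_0:=\mathcal A|_{D(\mathcal A)\cap\ker\mathcal B}$ generates a $C_0$-semigroup $S$ on $\mathcal H$; 2. there is a lifting operator, i.e. a bounded linear $B:\mathbb K^m\to\mathcal H$ with $\mathrm R(B)\subset D(\mathcal A)$, $\mathcal AB$ bounded and $\mathcal BB=I$; 3. $\mathcal A_0$ is closed with simple eigenvalues $\lambda_n$ and eigenvectors $\phi_n$, $n\in\mathbb N$, such that $\overline{\mathrm{span}}\{\phi_n\}=\mathcal H$; for constants $m_R,M_R>0$, $m_R\sum_{n\le N}|\alpha_n|^2\le\|\sum_{n\le N}\alpha_n\phi_n\|^2\le M_R\sum_{n\le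 N}|\alpha_n|^2$ for all $N$ and all scalars $\alpha_n$; and $\overline{\{\lambda_n\}}$ contains no segment $[a,b]$ with $a\ne b$. Assume moreover that $\omega_0:=\sup_n\operatorname{Re}\lambda_n<0$, and let $\kappa_0:=-\omega_0$. **Weak solutions.** For $X_0\in\mathcal H$, $d\in\mathcal C^0(\mathbb R_+;\mathbb K^m)$ and $U\in\mathcal C^0(\mathbb R_+;\mathcal H)$, a function $X\in\mathcal C^0(\mathbb R_+;\mathcal H)$ is a weak solution associated with $(X_0,d,U)$ if for all $T>0$ and all $z\in\mathcal C^1([0,T];\mathcal H)$ with values in $D(\mathcal A_0^*)$, $\mathcal A_0^*z\in\mathcal C^0([0,T];\mathcal H)$ and $z(T)=0$, $$\int_0^T\Big\langle X,\mathcal A_0^*z+\frac{\mathrm dz}{\mathrm dt}\Big\rangle\mathrm dt=-\langle X_0,z(0)\rangle+\int_0^T\langle Bd,\mathcal A_0^*z\rangle\,\mathrm dt-\int_0^T\langle\mathcal ABd,z\rangle\,\mathrm dt-\int_0^T\langle U,z\rangle\,\mathrm dt,$$ where $B$ is an arbitrary lifting operator. **Claim.** First, $\omega_0$ is the growth bound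 of $S$; there is a unique sequence $(\psi_n)$ in $\mathcal H$ with $\langle\phi_n,\psi_k\rangle=\delta_{n,k}$; and for every $e\in\mathbb K^m$ there is a unique $X_e\in D(\mathcal A)$ with $\mathcal AX_e=0$ and $\mathcal BX_e=e$. Suppose in addition that one of the following conditions holds: * (a) $\zeta:=\sup_n|\lambda_n|/|\operatorname{Re}\lambda_n|<\infty$; * (b) for some lifting operator $B$ and some basis $(e_1,\dots,e_m)$ of $\mathbb K^m$, $\sum_{n}\big|\tfrac{\lambda_n}{\operatorname{Re}\lambda_n}\big|^2|\langle Be_k,\psi_n\rangle|^2<\infty$ for all $k$. Then for all $X_0\in\mathcal H$, $d\in\mathcal C^0(\mathbb R_+;\mathbb K^m)$, $U\in\mathcal C^0(\mathbb R_+;\mathcal H)$ there is a unique weak solution $X$ associated with $(X_0,d,U)$, and for all $t\ge0$ $$\|X(t)\|\le C_0e^{-\kappa_0t}\|X_0\|+C_1\sup_{[0,t]}\|d\|+C_2\sup_{[0,t]}\|U\|,\qquad C_0=\sqrt{\tfrac{M_R}{m_R}},\quad C_2=\tfrac1{\kappa_0}\sqrt{\tfrac{M_R}{m_R}},$$ with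 positive constants, where, for any basis $\mathcal E=(e_1,\dots,e_m)$ of $\mathbb K^m$, any lifting operator $B$, and $c(\mathcal E)$ the smallest constant with $\|\cdot\|_{\infty,\mathcal E}\le c(\mathcal E)\|\cdot\|_{\mathbb K^m}$ (here $\|\cdot\|_{\infty,\mathcal E}$ is the maximum of the absolute values of the components in $\mathcal E$), $C_1$ may be taken as follows: * under (a), either of $$C_1=\sqrt{\tfrac{M_R}{m_R}}\Big\{\tfrac1{\kappa_0}\|\mathcal AB\|+\zeta\,c(\mathcal E)\sqrt{m\sum_{k=1}^m\|Be_k\|^2}\Big\},\qquad C_1=\zeta\,c(\mathcal E)\sqrt{m\tfrac{M_R}{m_R}\sum_{k=1}^m\|X_{e_k}\|^2};$$ * under (b), in which case the series in (b) converge for every $B$ and every $\mathcal E$, $$C_1=\tfrac1{\kappa_0}\sqrt{\tfrac{M_R}{m_R}}\,\|\mathcal AB\|+c(\mathcal E)\sqrt{mM_R\sum_{k=1}^m\sum_{n}\Big|\tfrac{\lambda_n}{\operatorname{Re}\lambda_n}\Big|^2|\langle Be_k,\psi_n\rangle|^2}.$$ -/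

import Mathlib

open Set Filter Topology MeasureTheory

noncomputable section

namespace RieszBCS

variable {K H V : Type*} [RCLike K]
  [NormedAddCommGroup H] [InnerProductSpace K H]
  [NormedAddCommGroup V] [NormedSpace K V]

/-! ### Semigroups, generators and growth bounds -/

/-- `S t`, `t ≥ 0`, is a strongly continuous semigroup of bounded operators
(the values of `S` at negative times are irrelevant). -/
structure IsC0Semigroup (S : ℝ → H →L[K] H) : Prop where
  zero : S 0 = 1
  add : ∀ s t : ℝ, 0 ≤ s → 0 ≤ t → S (s + t) = S s * S t
  strong : ∀ x : H, Tendsto (fun t : ℝ => S t x) (𝓝[>] 0) (𝓝 x)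

/-- `A` is the infinitesimal generator of `S`: `x ∈ D(A)` with `A x = y` if and only if
`(S t x - x) / t → y` as `t → 0+`. -/
def IsGenerator (S : ℝ → H →L[K] H) (A : H →ₗ.[K] H) : Prop :=
  ∀ x y : H, (x, y) ∈ A.graph ↔
    Tendsto (fun t : ℝ => ((t : K))⁻¹ • (S t x - x)) (𝓝[>] 0) (𝓝 y)

/-- `ω` is the growth bound of `S`. -/
def IsGrowthBound (S : ℝ → H →L[K] H) (ω : ℝ) : Prop :=
  IsGLB {w : ℝ | ∃ M : ℝ, ∀ t : ℝ, 0 ≤ t → ‖S t‖ ≤ M * Real.exp (w * t)} ω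

/-! ### Boundary control systems -/

/-- The disturbance free operator `𝒜₀`: the restriction of `𝒜` to `D(𝒜) ∩ ker ℬ`. -/
def disturbanceFree (A : H →ₗ.[K] H) (Bd : H →ₗ.[K] V) : H →ₗ.[K] H :=
  A.domRestrict ((LinearMap.ker Bd.toFun).map Bd.domain.subtype)

theorem mem_graph_disturbanceFree (A : H →ₗ.[K] H) (Bd : H →ₗ.[K] V) (x y : H) :
    (x, y) ∈ (disturbanceFree A Bd).graph ↔ (x, y) ∈ A.graph ∧ (x, (0 : V)) ∈ Bd.graph := by
  simp only [LinearPMap.mem_graph_iff]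
  constructor
  · rintro ⟨z, hz, hy⟩
    obtain ⟨⟨w, hw, hwz⟩, hzA⟩ := z.2
    refine ⟨⟨⟨z, hzA⟩, hz, ?_⟩, w, ?_, ?_⟩
    · rw [← hy]; exact (LinearPMap.domRestrict_apply rfl).symm
    · exact hwz.trans hz
    · simpa using hw
  · rintro ⟨⟨z, hz, hy⟩, w, hw, hw0⟩
    refine ⟨⟨z, ⟨w, by simpa using hw0, ?_⟩, z.2⟩, hz, ?_⟩
    · simp [hw, hz]
    · rw [← hy]; exact LinearPMap.domRestrict_apply rfl

/-- `B` is a lifting operator: `R(B) ⊆ D(𝒜)`, `𝒜 B = AB` is bounded and `ℬ B = I`. -/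
structure IsLifting (A : H →ₗ.[K] H) (Bd : H →ₗ.[K] V) (B AB : V →L[K] H) : Prop where
  op : ∀ v : V, (B v, AB v) ∈ A.graph
  bdry : ∀ v : V, (B v, v) ∈ Bd.graph

/-- `(𝒜, ℬ)` is a boundary control system. -/
structure IsBoundaryControlSystem (A : H →ₗ.[K] H) (Bd : H →ₗ.[K] V) : Prop where
  domain_le : A.domain ≤ Bd.domain
  generator : ∃ S : ℝ → H →L[K] H, IsC0Semigroup S ∧ IsGenerator S (disturbanceFree A Bd)
  lifting : ∃ B AB : V →L[K] H, IsLifting A Bd B AB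

/-! ### Riesz-spectral operators -/

/-- `φ` is a Riesz basis with constants `mR`, `MR`. -/
structure IsRieszBasis (K : Type*) {H : Type*} [RCLike K] [NormedAddCommGroup H]
    [InnerProductSpace K H] (φ : ℕ → H) (mR MR : ℝ) : Prop where
  maximal : closure (Submodule.span K (range φ) : Set H) = univ
  lower_pos : 0 < mR
  upper_pos : 0 < MR
  lower : ∀ (N : ℕ) (a : ℕ → K),
    mR * ∑ n ∈ Finset.range (N + 1), ‖a n‖ ^ 2 ≤ ‖∑ n ∈ Finset.range (N + 1), a n • φ n‖ ^ 2
  upper : ∀ (N : ℕ) (a : ℕ → K),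
    ‖∑ n ∈ Finset.range (N + 1), a n • φ n‖ ^ 2 ≤ MR * ∑ n ∈ Finset.range (N + 1), ‖a n‖ ^ 2

/-- `A₀` is a Riesz-spectral operator with simple eigenvalues `ev n`, eigenvectors `φ n` and
Riesz constants `mR`, `MR`. -/
structure IsRieszSpectral (A₀ : H →ₗ.[K] H) (ev : ℕ → K) (φ : ℕ → H) (mR MR : ℝ) : Prop where
  closed : A₀.IsClosed
  eigen : ∀ n, (φ n, ev n • φ n) ∈ A₀.graph
  simple : ∀ (n : ℕ) (x : H), (x, ev n • x) ∈ A₀.graph → x ∈ Submodule.span K {φ n}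
  riesz : IsRieszBasis K φ mR MR
  disconnected : ∀ a ∈ closure (range ev), ∀ b ∈ closure (range ev), a ≠ b →
    ¬ segment ℝ a b ⊆ closure (range ev)

/-- `(𝒜, ℬ)` is a Riesz-spectral boundary control system with the given spectral data. -/
structure IsRieszSpectralBCS (A : H →ₗ.[K] H) (Bd : H →ₗ.[K] V)
    (ev : ℕ → K) (φ : ℕ → H) (mR MR : ℝ) : Prop where
  bcs : IsBoundaryControlSystem A Bd
  spectral : IsRieszSpectral (disturbanceFree A Bd) ev φ mR MR

/-- `⟨φ n, ψ k⟩ = δ_{n,k}` (Mathlib's inner product is linear in its second argument). -/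
def IsBiorthogonal (K : Type*) {H : Type*} [RCLike K] [NormedAddCommGroup H]
    [InnerProductSpace K H] (φ ψ : ℕ → H) : Prop :=
  ∀ n k : ℕ, inner K (ψ k) (φ n) = if n = k then (1 : K) else 0

/-- The ratio `|λ| / |Re λ|`. -/
def dampingRatio (z : K) : ℝ := ‖z‖ / |RCLike.re z|

/-- The terms `|λ_n / Re λ_n|² |⟨B e, ψ_n⟩|²`. -/
def relaxedTerm (ev : ℕ → K) (ψ : ℕ → H) (B : V →L[K] H) (e : V) (n : ℕ) : ℝ :=
  dampingRatio (ev n) ^ 2 * ‖inner K (ψ n) (B e)‖ ^ 2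

/-- The relaxed summability condition, for some lifting operator and some basis of the
boundary input space. -/
def RelaxedDamping (A : H →ₗ.[K] H) (Bd : H →ₗ.[K] V) (m : ℕ) (ev : ℕ → K) (ψ : ℕ → H) : Prop :=
  ∃ B AB : V →L[K] H, IsLifting A Bd B AB ∧ ∃ E : Module.Basis (Fin m) K V,
    ∀ k : Fin m, Summable (relaxedTerm ev ψ B (E k))

/-! ### Weak solutions -/

/-- `z` is a test function over `[0, T]`, with time derivative `z'` and `w = A₀* z` on `[0, T]`;
here `adj` is the adjoint `A₀*`. -/
structure IsTestFunction [NormedSpace ℝ H] (adj : H →ₗ.[K] H) (T : ℝ) (z z' w : ℝ → H) :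
    Prop where
  hasDeriv : ∀ t ∈ Icc 0 T, HasDerivWithinAt z (z' t) (Icc 0 T) t
  continuousOn_deriv : ContinuousOn z' (Icc 0 T)
  mem_adjoint : ∀ t ∈ Icc 0 T, (z t, w t) ∈ adj.graph
  continuousOn_adjoint : ContinuousOn w (Icc 0 T)
  terminal : z T = 0

/-- `X` (restricted to `[0, ∞)`) is a weak solution associated with `(X₀, d, U)`. The scalar
product `⟨x, y⟩`, linear in `x`, is written `inner K y x`. -/
structure IsWeakSolution [CompleteSpace H] [NormedSpace ℝ H] (A : H →ₗ.[K] H) (Bd : H →ₗ.[K] V)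
    (X₀ : H) (d : ℝ → V) (U : ℝ → H) (X : ℝ → H) : Prop where
  continuousOn : ContinuousOn X (Ici 0)
  weak : ∀ B AB : V →L[K] H, IsLifting A Bd B AB → ∀ T : ℝ, 0 < T → ∀ z z' w : ℝ → H,
    IsTestFunction (disturbanceFree A Bd).adjoint T z z' w →
    ∫ t in (0 : ℝ)..T, inner K (w t + z' t) (X t)
      = - inner K (z 0) X₀
        + (∫ t in (0 : ℝ)..T, inner K (w t) (B (d t)))
        - (∫ t in (0 : ℝ)..T, inner K (z t) (AB (d t)))
        - ∫ t in (0 : ℝ)..T, inner K (z t) (U t)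

/-- Every initial condition in `H` and all continuous disturbances on `[0, ∞)` give a weak
solution, which is unique as a function on `[0, ∞)`. -/
def HasUniqueWeakSolutions [CompleteSpace H] [NormedSpace ℝ H] (A : H →ₗ.[K] H)
    (Bd : H →ₗ.[K] V) : Prop :=
  ∀ (X₀ : H) (d : ℝ → V) (U : ℝ → H), ContinuousOn d (Ici 0) → ContinuousOn U (Ici 0) →
    ∃ X : ℝ → H, IsWeakSolution A Bd X₀ d U X ∧
      ∀ Y : ℝ → H, IsWeakSolution A Bd X₀ d U Y → EqOn Y X (Ici 0)

/-! ### The ISS estimate and its constants -/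

/-- The supremum norm of `f` over `[0, t]`. -/
def supNorm {F : Type*} [NormedAddCommGroup F] (f : ℝ → F) (t : ℝ) : ℝ :=
  sSup ((fun s => ‖f s‖) '' Icc 0 t)

/-- The exponential ISS estimate, with positive constants `κ₀, C₀, C₁, C₂`, for all weak
solutions. -/
def WeakExpISS [CompleteSpace H] [NormedSpace ℝ H] (A : H →ₗ.[K] H) (Bd : H →ₗ.[K] V)
    (κ₀ C₀ C₁ C₂ : ℝ) : Prop :=
  0 < κ₀ ∧ 0 < C₀ ∧ 0 < C₁ ∧ 0 < C₂ ∧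
  ∀ (X₀ : H) (d : ℝ → V) (U : ℝ → H), ContinuousOn d (Ici 0) → ContinuousOn U (Ici 0) →
    ∀ X : ℝ → H, IsWeakSolution A Bd X₀ d U X → ∀ t : ℝ, 0 ≤ t →
      ‖X t‖ ≤ C₀ * Real.exp (-κ₀ * t) * ‖X₀‖ + C₁ * supNorm d t + C₂ * supNorm U t

/-- `c(ℰ)`: the smallest constant `c` such that `‖v‖_{∞,ℰ} ≤ c ‖v‖` for all `v`. The norm of
`Fin m → K` is the maximum of the absolute values of the components. -/
def basisConst {m : ℕ} (E : Module.Basis (Fin m) K V) : ℝ :=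
  sInf {c : ℝ | ∀ v : V, ‖E.equivFun v‖ ≤ c * ‖v‖}

/-- `C₁` from a lifting operator. -/
def C1Lifting {m : ℕ} (κ₀ ζ mR MR : ℝ) (E : Module.Basis (Fin m) K V) (B AB : V →L[K] H) : ℝ :=
  √(MR / mR) * (1 / κ₀ * ‖AB‖ + ζ * basisConst E * √(m * ∑ k, ‖B (E k)‖ ^ 2))

/-- `C₁` from stationary solutions `Xe k`. -/
def C1Stationary {m : ℕ} (ζ mR MR : ℝ) (E : Module.Basis (Fin m) K V) (Xe : Fin m → H) : ℝ :=
  ζ * basisConst E * √(m * (MR / mR) * ∑ k, ‖Xe k‖ ^ 2)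

/-- `C₁` under the relaxed summability condition. -/
def C1Relaxed {m : ℕ} (κ₀ mR MR : ℝ) (E : Module.Basis (Fin m) K V) (B AB : V →L[K] H)
    (ev : ℕ → K) (ψ : ℕ → H) : ℝ :=
  1 / κ₀ * √(MR / mR) * ‖AB‖
    + basisConst E * √(m * MR * ∑ k, ∑' n, relaxedTerm ev ψ B (E k) n)

/-- `x ∈ D(𝒜)` solves `𝒜 x = 0`, `ℬ x = e`. -/
def IsStationaryState (A : H →ₗ.[K] H) (Bd : H →ₗ.[K] V) (e : V) (x : H) : Prop :=
  (x, (0 : H)) ∈ A.graph ∧ (x, e) ∈ Bd.graph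

end RieszBCS

end

open RieszBCS

noncomputable section

namespace RieszBCS

/-! ### Riesz bases: biorthogonal sequence, Bessel inequality, expansion and synthesis. -/

section RieszBasis

variable {K H : Type*} [RCLike K] [NormedAddCommGroup H] [InnerProductSpace K H]
  {φ ψ : ℕ → H} {mR MR : ℝ}

/-! In the Riesz basis the system decouples. Write `c_n = ⟨X, ψ_n⟩`. Testing the weak equation
against multiples of `ψ_n` gives the scalar equation `c_n' = λ_n c_n + ⟨𝒜B d + U, ψ_n⟩ - λ_n ⟨B d,
ψ_n⟩`, in which `d` is never differentiated, so continuous inputs suffice.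

The solution is a sum of two parts. The first is the mild solution with initial value `X₀` and
forcing `𝒜B d + U`; since `‖S t‖ ≤ √(MR/mR) e^{-κ₀ t}`, it contributes `C₀`, `C₂` and the `‖𝒜B‖`
term of `C₁`. The second is a boundary part `Z` with coefficients `-∫₀ᵗ e^{λ_n(t-s)} λ_n ⟨B d(s),
ψ_n⟩ ds`. The factor `λ_n` is unbounded in general, but `|λ_n| ∫₀ᵗ e^{Re λ_n (t-s)} ds ≤ |λ_n| / |Re
λ_n|`, so condition (b) bounds the squared coefficients by a summable sequence uniformly on compact
time intervals. Riesz synthesis then yields `Z t`, its continuity in `t` and its norm bound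
(`exists_boundaryPart`).

Conversely, a function with these coefficients satisfies the weak equation: this holds for each
finite section by the fundamental theorem of calculus and passes to the limit by dominated
convergence (`weak_equation_of_coeff`). Uniqueness (`IsWeakSolution.eqOn`) uses a test function `f
ψ_n` with `f` solving a backward scalar equation.

The other cases reduce to (b). Under (a), Bessel's inequality bounds the series in (b) by `ζ² ‖B e‖²
/ mR`. Stationary solutions define a lifting with `𝒜B = 0`. Two liftings differ by an operator into
`D(𝒜₀)`, where the factor `λ_n` is absorbed by `𝒜₀`; hence neither (b) nor the weak equation depends
on the lifting. -/

theorem IsRieszBasis.dense_span (h : IsRieszBasis K φ mR MR) :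
    Dense (Submodule.span K (range φ) : Set H) :=
  dense_iff_closure_eq.2 h.maximal

theorem IsRieszBasis.lower_range (h : IsRieszBasis K φ mR MR) (N : ℕ) (a : ℕ → K) :
    mR * ∑ n ∈ Finset.range N, ‖a n‖ ^ 2 ≤ ‖∑ n ∈ Finset.range N, a n • φ n‖ ^ 2 := by
  cases N with
  | zero => simp
  | succ N => exact h.lower N a

theorem IsRieszBasis.upper_range (h : IsRieszBasis K φ mR MR) (N : ℕ) (a : ℕ → K) :
    ‖∑ n ∈ Finset.range N, a n • φ n‖ ^ 2 ≤ MR * ∑ n ∈ Finset.range N, ‖a n‖ ^ 2 := by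
  cases N with
  | zero => simp
  | succ N => exact h.upper N a

/-- The upper Riesz bound over an arbitrary finite set of indices. -/
theorem IsRieszBasis.upper_finset (h : IsRieszBasis K φ mR MR) (s : Finset ℕ) (a : ℕ → K) :
    ‖∑ n ∈ s, a n • φ n‖ ^ 2 ≤ MR * ∑ n ∈ s, ‖a n‖ ^ 2 := by
  classical
  obtain ⟨N, hN⟩ := s.exists_nat_subset_range
  have := h.upper_range N (fun n => if n ∈ s then a n else 0)
  have h1 : ∑ n ∈ Finset.range N, (if n ∈ s then a n else 0) • φ n = ∑ n ∈ s, a n • φ n := by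
    rw [← Finset.sum_subset hN (fun n _ hn => by simp [hn])]
    exact Finset.sum_congr rfl fun n hn => by simp [hn]
  have h2 : ∑ n ∈ Finset.range N, ‖if n ∈ s then a n else 0‖ ^ 2 = ∑ n ∈ s, ‖a n‖ ^ 2 := by
    rw [← Finset.sum_subset hN (fun n _ hn => by simp [hn])]
    exact Finset.sum_congr rfl fun n hn => by simp [hn]
  rwa [h1, h2] at this

theorem IsRieszBasis.lower_finset (h : IsRieszBasis K φ mR MR) (s : Finset ℕ) (a : ℕ → K) :
    mR * ∑ n ∈ s, ‖a n‖ ^ 2 ≤ ‖∑ n ∈ s, a n • φ n‖ ^ 2 := by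
  classical
  obtain ⟨N, hN⟩ := s.exists_nat_subset_range
  have := h.lower_range N (fun n => if n ∈ s then a n else 0)
  have h1 : ∑ n ∈ Finset.range N, (if n ∈ s then a n else 0) • φ n = ∑ n ∈ s, a n • φ n := by
    rw [← Finset.sum_subset hN (fun n _ hn => by simp [hn])]
    exact Finset.sum_congr rfl fun n hn => by simp [hn]
  have h2 : ∑ n ∈ Finset.range N, ‖if n ∈ s then a n else 0‖ ^ 2 = ∑ n ∈ s, ‖a n‖ ^ 2 := by
    rw [← Finset.sum_subset hN (fun n _ hn => by simp [hn])]
    exact Finset.sum_congr rfl fun n hn => by simp [hn]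
  rwa [h1, h2] at this

/-- The lower Riesz bound with coefficient 1 at `n` keeps `φ n` at distance at least `√mR` from
every combination of the other vectors. -/
theorem IsRieszBasis.notMem_closure_span (h : IsRieszBasis K φ mR MR) (n : ℕ) :
    φ n ∉ closure (Submodule.span K (φ '' {n}ᶜ) : Set H) := by
  classical
  intro hn
  have hpos := Real.sqrt_pos.2 h.lower_pos
  obtain ⟨y, hy, hd⟩ := Metric.mem_closure_iff.1 hn _ hpos
  obtain ⟨f, hf, rfl⟩ := (Finsupp.mem_span_image_iff_linearCombination K).1 hy
  have hfn : n ∉ f.support := fun h' => by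
    have := (Finsupp.mem_supported K f).1 hf h'
    simp at this
  have h1 := h.lower_finset (insert n f.support) (fun k => if k = n then 1 else - f k)
  rw [Finset.sum_insert hfn, Finset.sum_insert hfn] at h1
  have h2 : ∑ k ∈ f.support, (if k = n then (1 : K) else - f k) • φ k
      = - Finsupp.linearCombination K φ f := by
    rw [Finsupp.linearCombination_apply, Finsupp.sum, ← Finset.sum_neg_distrib]
    refine Finset.sum_congr rfl fun k hk => ?_
    have : k ≠ n := fun e => hfn (e ▸ hk)
    simp [this]
  rw [h2] at h1
  have h3 : 0 ≤ ∑ k ∈ f.support, ‖if k = n then (1 : K) else - f k‖ ^ 2 :=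
    Finset.sum_nonneg fun _ _ => by positivity
  simp only [if_true, norm_one, one_smul, one_pow, ← sub_eq_add_neg] at h1
  rw [dist_eq_norm] at hd
  have h4 := (Real.lt_sqrt (norm_nonneg _)).1 hd
  nlinarith [h.lower_pos, mul_nonneg h.lower_pos.le h3]

/-- `ψ k` is the component of `φ k` orthogonal to the closed span of the other vectors, rescaled; it
is nonzero by `notMem_closure_span`. -/
theorem IsRieszBasis.exists_biorthogonal [CompleteSpace H] (h : IsRieszBasis K φ mR MR) :
    ∃ ψ : ℕ → H, IsBiorthogonal K φ ψ := by
  have key : ∀ k, ∃ x : H, ∀ n, inner K x (φ n) = if n = k then (1 : K) else 0 := by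
    intro k
    set W := (Submodule.span K (φ '' {k}ᶜ)).topologicalClosure with hW
    have : CompleteSpace W := by
      rw [hW]; exact (Submodule.isClosed_topologicalClosure _).completeSpace_coe
    have hk : φ k ∉ W := fun hk => h.notMem_closure_span k
      (by rwa [hW, ← SetLike.mem_coe, Submodule.topologicalClosure_coe] at hk)
    set v := φ k - W.starProjection (φ k) with hv
    have hvW : v ∈ Wᗮ := W.sub_starProjection_mem_orthogonal (φ k)
    have hv0 : v ≠ 0 := fun h0 => hk <| by
      rw [sub_eq_zero.1 h0]; exact Submodule.starProjection_apply_mem _ _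
    have hin : inner K v (φ k) = inner K v v := by
      have : φ k = v + W.starProjection (φ k) := by simp [hv]
      conv_lhs => rw [this, inner_add_right]
      rw [Submodule.inner_left_of_mem_orthogonal (Submodule.starProjection_apply_mem _ _) hvW,
        add_zero]
    have hne : inner K v v ≠ (0 : K) := inner_self_ne_zero.2 hv0
    refine ⟨(starRingEnd K (inner K v v)⁻¹) • v, fun n => ?_⟩
    rw [inner_smul_left, RCLike.conj_conj]
    split_ifs with hnk
    · rw [hnk, hin, inv_mul_cancel₀ hne]
    · have : φ n ∈ W := Submodule.le_topologicalClosure _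
        (Submodule.subset_span ⟨n, by simpa using hnk, rfl⟩)
      rw [Submodule.inner_left_of_mem_orthogonal this hvW, mul_zero]
  choose ψ hψ using key
  exact ⟨ψ, fun n k => hψ k n⟩

/-- The partial sum operator `x ↦ ∑_{n < N} ⟨x, ψ n⟩ φ n`. -/
def partialSum (K : Type*) {H : Type*} [RCLike K] [NormedAddCommGroup H] [InnerProductSpace K H]
    (φ ψ : ℕ → H) (N : ℕ) : H →L[K] H :=
  ∑ n ∈ Finset.range N, (innerSL K (ψ n)).smulRight (φ n)

theorem partialSum_apply (N : ℕ) (x : H) :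
    partialSum K φ ψ N x = ∑ n ∈ Finset.range N, inner K (ψ n) x • φ n := by
  simp [partialSum]

theorem IsBiorthogonal.inner_sum (hψ : IsBiorthogonal K φ ψ) (N k : ℕ) (a : ℕ → K) :
    inner K (ψ k) (∑ n ∈ Finset.range N, a n • φ n) = if k < N then a k else 0 := by
  simp only [_root_.inner_sum, inner_smul_right, hψ _ _, mul_ite, mul_one, mul_zero]
  simp

theorem IsBiorthogonal.eventually_partialSum_eq (hψ : IsBiorthogonal K φ ψ) {x : H}
    (hx : x ∈ Submodule.span K (range φ)) : ∀ᶠ N in atTop, partialSum K φ ψ N x = x := by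
  induction hx using Submodule.span_induction with
  | mem x hx =>
    obtain ⟨k, rfl⟩ := hx
    filter_upwards [eventually_gt_atTop k] with N hN
    rw [partialSum_apply]
    simp only [hψ _ _, ite_smul, one_smul, zero_smul]
    simp [hN]
  | zero => simp
  | add x y _ _ hx hy => filter_upwards [hx, hy] with N h1 h2 using by rw [map_add, h1, h2]
  | smul a x _ hx => filter_upwards [hx] with N h1 using by rw [map_smul, h1]

/-- On the span this is the lower Riesz bound for a partial sum long enough to reproduce `x`. The
inequality is a closed condition, so density extends it. -/
theorem IsRieszBasis.bessel (h : IsRieszBasis K φ mR MR) (hψ : IsBiorthogonal K φ ψ)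
    (N : ℕ) (x : H) :
    mR * ∑ n ∈ Finset.range N, ‖inner K (ψ n) x‖ ^ 2 ≤ ‖x‖ ^ 2 := by
  have hc : IsClosed {x : H | mR * ∑ n ∈ Finset.range N, ‖inner K (ψ n) x‖ ^ 2 ≤ ‖x‖ ^ 2} :=
    isClosed_le (by fun_prop) (by fun_prop)
  refine h.dense_span.induction (P := fun x =>
    mR * ∑ n ∈ Finset.range N, ‖inner K (ψ n) x‖ ^ 2 ≤ ‖x‖ ^ 2) (fun x hx => ?_) hc x
  obtain ⟨M, hM, hNM⟩ := ((hψ.eventually_partialSum_eq hx).and (eventually_ge_atTop N)).exists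
  have := h.lower_range M (fun n => inner K (ψ n) x)
  rw [← partialSum_apply, hM] at this
  refine le_trans (mul_le_mul_of_nonneg_left ?_ h.lower_pos.le) this
  exact Finset.sum_le_sum_of_subset_of_nonneg (by simpa using hNM) fun _ _ _ => by positivity

theorem IsRieszBasis.summable_coeff (h : IsRieszBasis K φ mR MR) (hψ : IsBiorthogonal K φ ψ)
    (x : H) : Summable fun n => ‖inner K (ψ n) x‖ ^ 2 :=
  summable_of_sum_range_le (c := ‖x‖ ^ 2 / mR) (fun _ => by positivity) fun N => by
    rw [le_div_iff₀ h.lower_pos, mul_comm]; exact h.bessel hψ N x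

theorem IsRieszBasis.tsum_coeff_le (h : IsRieszBasis K φ mR MR) (hψ : IsBiorthogonal K φ ψ)
    (x : H) : ∑' n, ‖inner K (ψ n) x‖ ^ 2 ≤ ‖x‖ ^ 2 / mR :=
  (h.summable_coeff hψ x).tsum_le_of_sum_range_le fun N => by
    rw [le_div_iff₀ h.lower_pos, mul_comm]; exact h.bessel hψ N x

theorem IsRieszBasis.norm_partialSum_le (h : IsRieszBasis K φ mR MR) (hψ : IsBiorthogonal K φ ψ)
    (N : ℕ) (x : H) : ‖partialSum K φ ψ N x‖ ≤ √(MR / mR) * ‖x‖ := by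
  rw [← Real.sqrt_sq (norm_nonneg x), ← Real.sqrt_mul' _ (by positivity)]
  refine Real.le_sqrt_of_sq_le ?_
  rw [partialSum_apply]
  refine (h.upper_range N _).trans ?_
  have := h.bessel hψ N x
  rw [div_mul_eq_mul_div, le_div_iff₀ h.lower_pos, mul_assoc]
  exact mul_le_mul_of_nonneg_left (by linarith) h.upper_pos.le

/-- The partial sum operators are uniformly bounded and eventually exact on the dense span. -/
theorem IsRieszBasis.tendsto_partialSum (h : IsRieszBasis K φ mR MR)
    (hψ : IsBiorthogonal K φ ψ) (x : H) :
    Tendsto (fun N => partialSum K φ ψ N x) atTop (𝓝 x) := by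
  set C := √(MR / mR) with hC
  have hC0 : 0 ≤ C := Real.sqrt_nonneg _
  rw [Metric.tendsto_atTop]
  intro ε hε
  obtain ⟨y, hy, hxy⟩ := h.dense_span.exists_dist_lt x (ε := ε / (C + 1)) (by positivity)
  obtain ⟨N, hN⟩ := eventually_atTop.1 (hψ.eventually_partialSum_eq hy)
  refine ⟨N, fun n hn => ?_⟩
  have h1 : partialSum K φ ψ n x - x = partialSum K φ ψ n (x - y) - (x - y) := by
    rw [map_sub, hN n hn]; abel
  rw [dist_eq_norm, h1]
  rw [dist_eq_norm, lt_div_iff₀ (by positivity)] at hxy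
  calc _ ≤ ‖partialSum K φ ψ n (x - y)‖ + ‖x - y‖ := norm_sub_le _ _
    _ ≤ C * ‖x - y‖ + ‖x - y‖ := by gcongr; exact h.norm_partialSum_le hψ n _
    _ < ε := by linarith

/-- The upper Riesz bound in the limit: every norm estimate below is obtained by estimating
coefficients. -/
theorem IsRieszBasis.norm_sq_le_of_coeff (h : IsRieszBasis K φ mR MR)
    (hψ : IsBiorthogonal K φ ψ) {x : H} {c : ℝ}
    (hx : ∀ N, ∑ n ∈ Finset.range N, ‖inner K (ψ n) x‖ ^ 2 ≤ c) : ‖x‖ ^ 2 ≤ MR * c := by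
  refine le_of_tendsto ((h.tendsto_partialSum hψ x).norm.pow 2) (Eventually.of_forall fun N => ?_)
  rw [partialSum_apply]
  exact (h.upper_range N _).trans (mul_le_mul_of_nonneg_left (hx N) h.upper_pos.le)

theorem IsRieszBasis.eq_zero_of_coeff (h : IsRieszBasis K φ mR MR)
    (hψ : IsBiorthogonal K φ ψ) {x : H} (hx : ∀ n, inner K (ψ n) x = 0) : x = 0 := by
  have := h.norm_sq_le_of_coeff hψ (x := x) (c := 0) (by simp [hx])
  simpa using this

theorem IsRieszBasis.ext_coeff (h : IsRieszBasis K φ mR MR)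
    (hψ : IsBiorthogonal K φ ψ) {x y : H} (hx : ∀ n, inner K (ψ n) x = inner K (ψ n) y) :
    x = y :=
  sub_eq_zero.1 <| h.eq_zero_of_coeff hψ fun n => by rw [inner_sub_right, hx, sub_self]

theorem IsRieszBasis.biorthogonal_unique (h : IsRieszBasis K φ mR MR) {ψ' : ℕ → H}
    (hψ : IsBiorthogonal K φ ψ) (hψ' : IsBiorthogonal K φ ψ') : ψ' = ψ := by
  funext k
  refine h.dense_span.eq_of_inner_left K fun v hv => ?_
  induction hv using Submodule.span_induction with
  | mem x hx => obtain ⟨n, rfl⟩ := hx; rw [hψ, hψ']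
  | zero => simp
  | add x y _ _ hx hy => rw [inner_add_right, inner_add_right, hx, hy]
  | smul a x _ hx => rw [inner_smul_right, inner_smul_right, hx]

/-- The upper Riesz bound controls a block of the series by `MR` times the same block of `∑ b n`,
which does not see the parameter. -/
theorem IsRieszBasis.uniformCauchySeqOn (h : IsRieszBasis K φ mR MR) {ι : Type*} {s : Set ι}
    {a : ℕ → ι → K} {b : ℕ → ℝ} (hb : Summable b) (hab : ∀ n, ∀ t ∈ s, ‖a n t‖ ^ 2 ≤ b n) :
    UniformCauchySeqOn (fun N t => ∑ n ∈ Finset.range N, a n t • φ n) atTop s := by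
  rw [Metric.uniformCauchySeqOn_iff]
  intro ε hε
  have hc := Metric.cauchySeq_iff.1 hb.hasSum.tendsto_sum_nat.cauchySeq (ε ^ 2 / MR)
    (div_pos (by positivity) h.upper_pos)
  obtain ⟨N, hN⟩ := hc
  have key : ∀ m ≥ N, ∀ n ≥ m, ∀ t ∈ s, dist (∑ k ∈ Finset.range n, a k t • φ k)
      (∑ k ∈ Finset.range m, a k t • φ k) < ε := by
    intro m hm n hn t ht
    rw [dist_eq_norm, ← Finset.sum_Ico_eq_sub _ hn]
    refine lt_of_pow_lt_pow_left₀ 2 hε.le ?_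
    refine (h.upper_finset _ (fun k => a k t)).trans_lt ?_
    have h1 := hN n (hm.trans hn) m hm
    rw [dist_eq_norm, ← Finset.sum_Ico_eq_sub _ hn, lt_div_iff₀ h.upper_pos] at h1
    refine lt_of_le_of_lt ?_ h1
    rw [mul_comm]
    refine mul_le_mul_of_nonneg_right ?_ h.upper_pos.le
    exact (Finset.sum_le_sum fun k _ => hab k t ht).trans (Real.le_norm_self _)
  refine ⟨N, fun m hm n hn t ht => ?_⟩
  rcases le_total m n with hmn | hmn
  · rw [dist_comm]; exact key m hm n hmn t ht
  · exact key n hn m hmn t ht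

/-- Synthesis of a vector with square summable coefficients. -/
theorem IsRieszBasis.exists_coeff_eq [CompleteSpace H] (h : IsRieszBasis K φ mR MR)
    (hψ : IsBiorthogonal K φ ψ) {a : ℕ → K} (ha : Summable fun n => ‖a n‖ ^ 2) :
    ∃ x : H, ∀ n, inner K (ψ n) x = a n := by
  have hu := h.uniformCauchySeqOn (ι := Unit) (s := univ) (a := fun n _ => a n) ha
    (fun n t _ => le_rfl)
  obtain ⟨x, hx⟩ := cauchySeq_tendsto_of_complete (hu.cauchySeq (mem_univ ()))
  refine ⟨x, fun k => ?_⟩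
  refine tendsto_nhds_unique (((innerSL K (ψ k)).continuous.tendsto x).comp hx) ?_
  refine tendsto_const_nhds.congr' ?_
  filter_upwards [eventually_gt_atTop k] with N hN
  simp [-map_sum, hψ.inner_sum, hN]

theorem IsRieszBasis.continuousOn_of_coeff (h : IsRieszBasis K φ mR MR)
    (hψ : IsBiorthogonal K φ ψ) {ι : Type*} [TopologicalSpace ι] {s : Set ι} {Z : ι → H}
    {b : ℕ → ℝ} (hb : Summable b) (hab : ∀ n, ∀ t ∈ s, ‖inner K (ψ n) (Z t)‖ ^ 2 ≤ b n)
    (hc : ∀ n, ContinuousOn (fun t => inner K (ψ n) (Z t)) s) : ContinuousOn Z s := by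
  have hu := h.uniformCauchySeqOn (a := fun n t => inner K (ψ n) (Z t)) hb hab
  refine (hu.tendstoUniformlyOn_of_tendsto (f := Z) fun t _ => ?_).continuousOn
    (Frequently.of_forall fun N => ?_)
  · simpa only [partialSum_apply] using h.tendsto_partialSum hψ (Z t)
  · exact continuousOn_finsetSum _ fun n _ => (hc n).smul continuousOn_const

end RieszBasis

/-! ### Exponentials over `ℝ` or `ℂ` and the scalar inhomogeneous equation. -/

section Exponential

variable {K : Type*} [RCLike K]

/-- `exp z` times its conjugate is `exp (2 Re z)`, an argument valid for both scalar fields. -/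
theorem norm_exp_rclike (z : K) : ‖NormedSpace.exp z‖ = Real.exp (RCLike.re z) := by
  have h1 : NormedSpace.exp z * (starRingEnd K) (NormedSpace.exp z)
      = ((Real.exp (RCLike.re z) ^ 2 : ℝ) : K) := by
    rw [starRingEnd_apply, NormedSpace.star_exp, ← NormedSpace.exp_add, ← starRingEnd_apply,
      RCLike.add_conj, ← Real.exp_nat_mul, Real.exp_eq_exp_ℝ]
    have := NormedSpace.algebraMap_exp_comm (𝕂 := ℝ) (𝔸 := K) (2 * RCLike.re z)
    rw [RCLike.algebraMap_eq_ofReal] at this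
    push_cast at this ⊢
    rw [this]
  rw [RCLike.mul_conj] at h1
  have h2 : ‖NormedSpace.exp z‖ ^ 2 = Real.exp (RCLike.re z) ^ 2 := by exact_mod_cast h1
  exact (pow_left_inj₀ (norm_nonneg _) (Real.exp_pos _).le two_ne_zero).1 h2

theorem norm_exp_smul_rclike (t : ℝ) (z : K) :
    ‖NormedSpace.exp (t • z)‖ = Real.exp (RCLike.re z * t) := by
  rw [norm_exp_rclike, RCLike.smul_re, mul_comm]

theorem exp_add_smul (s t : ℝ) (z : K) :
    NormedSpace.exp ((s + t) • z) = NormedSpace.exp (s • z) * NormedSpace.exp (t • z) := by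
  rw [add_smul, NormedSpace.exp_add]

theorem exp_smul_mul_exp_neg_smul (t : ℝ) (z : K) :
    NormedSpace.exp (t • z) * NormedSpace.exp ((-t) • z) = 1 := by
  rw [← exp_add_smul]; simp

theorem hasDerivAt_exp_smul (z : K) (t : ℝ) :
    HasDerivAt (fun s : ℝ => NormedSpace.exp (s • z)) (NormedSpace.exp (t • z) * z) t :=
  hasDerivAt_exp_smul_const z t

theorem continuous_exp_smul (z : K) : Continuous fun s : ℝ => NormedSpace.exp (s • z) :=
  continuous_iff_continuousAt.2 fun t => (hasDerivAt_exp_smul z t).continuousAt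

/-- The solution of `c' = z c + h`, `c a = c₀`. -/
def scalarMild (z c₀ : K) (h : ℝ → K) (a t : ℝ) : K :=
  NormedSpace.exp ((t - a) • z) * (c₀ + ∫ s in a..t, NormedSpace.exp ((-(s - a)) • z) * h s)

theorem scalarMild_self (z c₀ : K) (h : ℝ → K) (a : ℝ) : scalarMild z c₀ h a a = c₀ := by
  simp [scalarMild]

/-- The base point `a` is free: `a = 0` serves the forward equation, `a = T` the backward equation
of the uniqueness proof. -/
theorem hasDerivAt_scalarMild (z c₀ : K) {h : ℝ → K} (hh : Continuous h) (a t : ℝ) :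
    HasDerivAt (scalarMild z c₀ h a) (z * scalarMild z c₀ h a t + h t) t := by
  have h1 : HasDerivAt (fun t : ℝ => NormedSpace.exp ((t - a) • z))
      (NormedSpace.exp ((t - a) • z) * z) t := by
    exact ((hasDerivAt_exp_smul z (t - a)).scomp t ((hasDerivAt_id t).sub_const a)).congr_deriv
      (one_smul ℝ _)
  have hc : Continuous fun s : ℝ => NormedSpace.exp ((-(s - a)) • z) * h s :=
    ((continuous_exp_smul z).comp (by fun_prop : Continuous fun s : ℝ => -(s - a))).mul hh
  have h2 := (hc.integral_hasStrictDerivAt a t).hasDerivAt.const_add c₀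
  have h3 := h1.mul h2
  refine h3.congr_deriv ?_
  rw [scalarMild, ← mul_assoc, exp_smul_mul_exp_neg_smul]
  ring

theorem continuous_scalarMild (z c₀ : K) {h : ℝ → K} (hh : Continuous h) (a : ℝ) :
    Continuous (scalarMild z c₀ h a) :=
  continuous_iff_continuousAt.2 fun t => (hasDerivAt_scalarMild z c₀ hh a t).continuousAt

theorem scalarMild_eq (z c₀ : K) (h : ℝ → K) (t : ℝ) :
    scalarMild z c₀ h 0 t = NormedSpace.exp (t • z) * c₀
      + ∫ s in (0 : ℝ)..t, NormedSpace.exp ((t - s) • z) * h s := by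
  rw [scalarMild, mul_add, sub_zero, ← intervalIntegral.integral_const_mul]
  congr 2
  funext s
  rw [← mul_assoc, ← exp_add_smul]
  congr 3
  simp [sub_eq_add_neg]

theorem integral_exp_mul_sub_le {r : ℝ} (hr : r < 0) (t : ℝ) :
    ∫ s in (0 : ℝ)..t, Real.exp (r * (t - s)) ≤ 1 / -r := by
  have h1 : ∀ s ∈ uIcc 0 t, HasDerivAt (fun s => Real.exp (r * (t - s)) / -r)
      (Real.exp (r * (t - s))) s := by
    intro s _
    have := (((hasDerivAt_id s).const_sub t).const_mul r).exp.div_const (-r)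
    refine this.congr_deriv ?_
    have : r ≠ 0 := hr.ne
    simp only [id]
    field_simp
  have hc : Continuous fun s => Real.exp (r * (t - s)) := by fun_prop
  rw [intervalIntegral.integral_eq_sub_of_hasDerivAt h1 (hc.intervalIntegrable _ _)]
  have : 0 ≤ Real.exp (r * (t - 0)) / -r := div_nonneg (Real.exp_pos _).le (by linarith)
  simp at this ⊢
  exact this

end Exponential

/-! ### Strongly continuous semigroups: local bounds, orbits, action on eigenvectors. -/

section Semigroup

variable {K H : Type*} [RCLike K] [NormedAddCommGroup H] [InnerProductSpace K H]
  {S : ℝ → H →L[K] H}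

theorem IsC0Semigroup.tendsto_nhdsGE (hS : IsC0Semigroup S) (x : H) :
    Tendsto (fun t => S t x) (𝓝[≥] 0) (𝓝 x) := by
  rw [← Ioi_insert, nhdsWithin_insert, tendsto_sup, tendsto_pure_left]
  refine ⟨fun s hs => ?_, hS.strong x⟩
  rw [hS.zero]
  exact mem_of_mem_nhds hs

/-- Otherwise some `t n → 0` has `‖S (t n)‖` unbounded, although each `S (t n) x` converges; this
contradicts Banach–Steinhaus. -/
theorem IsC0Semigroup.exists_bound_near_zero [CompleteSpace H] (hS : IsC0Semigroup S) :
    ∃ δ > 0, ∃ M, 1 ≤ M ∧ ∀ t ∈ Icc 0 δ, ‖S t‖ ≤ M := by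
  by_contra! hcon
  have h1 : ∀ n : ℕ, ∃ t ∈ Icc (0 : ℝ) (1 / (n + 1)), (n + 1 : ℝ) < ‖S t‖ := fun n =>
    hcon (1 / (n + 1)) (by positivity) (n + 1) (by simp)
  choose t ht htn using h1
  have ht0 : Tendsto t atTop (𝓝[≥] 0) := tendsto_nhdsWithin_iff.2
    ⟨squeeze_zero (fun n => (ht n).1) (fun n => (ht n).2) tendsto_one_div_add_atTop_nhds_zero_nat,
      Eventually.of_forall fun n => (ht n).1⟩
  obtain ⟨C, hC⟩ := banach_steinhaus (g := fun n => S (t n)) fun x => by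
    obtain ⟨C, hC⟩ := ((hS.tendsto_nhdsGE x).comp ht0).norm.bddAbove_range
    exact ⟨C, fun n => hC ⟨n, rfl⟩⟩
  obtain ⟨n, hn⟩ := exists_nat_gt C
  linarith [htn n, hC n]

theorem IsC0Semigroup.exists_bound [CompleteSpace H] (hS : IsC0Semigroup S) (T : ℝ) :
    ∃ M, ∀ t ∈ Icc 0 T, ‖S t‖ ≤ M := by
  obtain ⟨δ, hδ, M, hM, h⟩ := hS.exists_bound_near_zero
  have key : ∀ n : ℕ, ∀ t ∈ Icc 0 (n * δ), ‖S t‖ ≤ M ^ (n + 1) := by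
    intro n
    induction n with
    | zero =>
      intro t ht
      simp only [Nat.cast_zero, zero_mul, Icc_self, mem_singleton_iff] at ht
      simpa using h t (by simp [ht, hδ.le])
    | succ n ih =>
      intro t ht
      rcases le_total t δ with h' | h'
      · exact (h t ⟨ht.1, h'⟩).trans (le_self_pow₀ hM (by omega))
      · have : t = δ + (t - δ) := by ring
        rw [this, hS.add _ _ hδ.le (by linarith), pow_succ']
        refine (norm_mul_le _ _).trans ?_
        have h2 := ht.2
        push_cast at h2
        exact mul_le_mul (h δ ⟨hδ.le, le_rfl⟩) (ih _ ⟨by linarith, by linarith⟩) (norm_nonneg _)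
          (by linarith)
  obtain ⟨n, hn⟩ := exists_nat_gt (T / δ)
  rw [div_lt_iff₀ hδ] at hn
  exact ⟨M ^ (n + 1), fun t ht => key n t ⟨ht.1, ht.2.trans hn.le⟩⟩

/-- For `a ≤ b`, `S b x - S a x = S a (S (b - a) x - x)`. The local bound on `S a` reduces
continuity from either side to right continuity at 0. -/
theorem IsC0Semigroup.continuousOn_orbit [CompleteSpace H] (hS : IsC0Semigroup S) (x : H) :
    ContinuousOn (fun t => S t x) (Ici 0) := by
  intro t ht
  obtain ⟨M, hM⟩ := hS.exists_bound (t + 1)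
  have h0 : Tendsto (fun s => |s - t|) (𝓝[Ici 0] t) (𝓝[≥] 0) := by
    refine tendsto_nhdsWithin_iff.2 ⟨?_, Eventually.of_forall fun s => mem_Ici.2 (abs_nonneg _)⟩
    have : Tendsto (fun s => |s - t|) (𝓝 t) (𝓝 |t - t|) :=
      (continuous_id.sub continuous_const).abs.tendsto t
    simp only [sub_self, abs_zero] at this
    exact this.mono_left nhdsWithin_le_nhds
  have h1 := (((hS.tendsto_nhdsGE x).comp h0).sub_const x).norm.const_mul M
  simp only [sub_self, norm_zero, mul_zero] at h1
  rw [ContinuousWithinAt, tendsto_iff_norm_sub_tendsto_zero]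
  refine squeeze_zero' (Eventually.of_forall fun s => norm_nonneg _) ?_ h1
  have h2 : ∀ᶠ s in 𝓝[Ici 0] t, s < t + 1 :=
    nhdsWithin_le_nhds (Iio_mem_nhds (by linarith))
  have key : ∀ a b : ℝ, 0 ≤ a → a ≤ b → a ≤ t + 1 → ‖S b x - S a x‖ ≤ M * ‖S (b - a) x - x‖ := by
    intro a b ha hab ha'
    have : b = a + (b - a) := by ring
    conv_lhs => rw [this, hS.add a (b - a) ha (by linarith)]
    rw [mul_apply_eq_comp, ← map_sub]
    exact (S a).le_of_opNorm_le (hM a ⟨ha, ha'⟩) _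
  filter_upwards [h2, self_mem_nhdsWithin] with s hs hs0
  rcases le_total s t with h | h
  · rw [norm_sub_rev, Function.comp, abs_sub_comm, abs_of_nonneg (sub_nonneg.2 h)]
    exact key s t hs0 h hs.le
  · rw [Function.comp, abs_of_nonneg (sub_nonneg.2 h)]
    exact key t s ht h (by linarith)

/-- The function `s ↦ e^{-s λ} S s x` has zero right derivative, hence is constant. -/
theorem IsC0Semigroup.apply_eigenvector [CompleteSpace H] [NormedSpace ℝ H] [IsScalarTower ℝ K H]
    {A : H →ₗ.[K] H} (hS : IsC0Semigroup S) (hA : IsGenerator S A) {lam : K} {x : H}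
    (hx : (x, lam • x) ∈ A.graph) {t : ℝ} (ht : 0 ≤ t) :
    S t x = NormedSpace.exp (t • lam) • x := by
  set f : ℝ → H := fun s => NormedSpace.exp ((-s) • lam) • S s x with hf
  have hE : ∀ s : ℝ, HasDerivAt (fun s : ℝ => NormedSpace.exp ((-s) • lam))
      (-(NormedSpace.exp ((-s) • lam) * lam)) s := fun s => by
    exact ((hasDerivAt_exp_smul lam (-s)).scomp s (hasDerivAt_neg s)).congr_deriv
      (by rw [neg_smul, one_smul])
  have hc : ContinuousOn f (Icc 0 t) :=
    (continuous_iff_continuousAt.2 fun s => (hE s).continuousAt).continuousOn.smul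
      ((hS.continuousOn_orbit x).mono Icc_subset_Ici_self)
  have hd : ∀ s ∈ Ico 0 t, HasDerivWithinAt f 0 (Ici s) s := by
    intro s hs
    have h1 : HasDerivWithinAt (fun r => S r x) (lam • S s x) (Ici s) s := by
      rw [← hasDerivWithinAt_Ioi_iff_Ici, hasDerivWithinAt_iff_tendsto_slope' self_notMem_Ioi]
      have h2 : Tendsto (fun r => r - s) (𝓝[>] s) (𝓝[>] 0) := by
        refine tendsto_nhdsWithin_iff.2 ⟨?_, ?_⟩
        · have : Tendsto (fun r => r - s) (𝓝 s) (𝓝 (s - s)) :=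
            (continuous_id.sub continuous_const).tendsto s
          rw [sub_self] at this
          exact this.mono_left nhdsWithin_le_nhds
        · filter_upwards [self_mem_nhdsWithin] with r hr using mem_Ioi.2 (sub_pos.2 (mem_Ioi.1 hr))
      have h3 := ((S s).continuous.tendsto _).comp (((hA x _).1 hx).comp h2)
      rw [map_smul] at h3
      refine h3.congr' ?_
      filter_upwards [self_mem_nhdsWithin] with r hr
      have : r = s + (r - s) := by ring
      conv_rhs => rw [slope, this, hS.add s (r - s) hs.1 (sub_pos.2 (mem_Ioi.1 hr)).le]
      simp only [Function.comp, map_smul, map_sub, mul_apply_eq_comp, vsub_eq_sub,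
        add_sub_cancel_left]
      rw [← algebraMap_smul K (r - s)⁻¹, RCLike.algebraMap_eq_ofReal, RCLike.ofReal_inv,
        RCLike.ofReal_sub]
    refine ((hE s).hasDerivWithinAt.smul h1).congr_deriv ?_
    rw [neg_smul (_ * _), mul_smul, add_neg_cancel]
  have := constant_of_has_deriv_right_zero hc hd t ⟨ht, le_rfl⟩
  simp only [hf, neg_zero, zero_smul, NormedSpace.exp_zero, hS.zero, one_smul,
    one_apply_eq_self] at this
  conv_rhs => rw [← this, smul_smul, exp_smul_mul_exp_neg_smul, one_smul]

end Semigroup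

/-! ### Semigroups diagonal in a Riesz basis: growth bound, generator, mild solutions. -/

section Diagonal

variable {K H : Type*} [RCLike K] [NormedAddCommGroup H] [InnerProductSpace K H]
  {S : ℝ → H →L[K] H} {A : H →ₗ.[K] H} {ev : ℕ → K} {φ ψ : ℕ → H} {mR MR ω : ℝ}

/-- `S` is a strongly continuous semigroup that is diagonal in the Riesz basis `φ` with
biorthogonal sequence `ψ`, with eigenvalues `exp (t λ_n)` and `Re λ_n ≤ ω`. -/
structure IsDiagonalSemigroup (S : ℝ → H →L[K] H) (ev : ℕ → K) (φ ψ : ℕ → H) (mR MR ω : ℝ) :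
    Prop where
  riesz : IsRieszBasis K φ mR MR
  biorth : IsBiorthogonal K φ ψ
  c0 : IsC0Semigroup S
  coeff : ∀ (n : ℕ) (x : H) (t : ℝ), 0 ≤ t →
    inner K (ψ n) (S t x) = NormedSpace.exp (t • ev n) * inner K (ψ n) x
  re_le : ∀ n, RCLike.re (ev n) ≤ ω

theorem IsC0Semigroup.isDiagonalSemigroup [CompleteSpace H] [NormedSpace ℝ H]
    [IsScalarTower ℝ K H] (hS : IsC0Semigroup S) (hA : IsGenerator S A)
    (hφ : IsRieszBasis K φ mR MR) (hψ : IsBiorthogonal K φ ψ)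
    (hev : ∀ n, (φ n, ev n • φ n) ∈ A.graph) (hω : ∀ n, RCLike.re (ev n) ≤ ω) :
    IsDiagonalSemigroup S ev φ ψ mR MR ω where
  riesz := hφ
  biorth := hψ
  c0 := hS
  re_le := hω
  coeff n x t ht := by
    have : (innerSL K (ψ n)).comp (S t) = NormedSpace.exp (t • ev n) • innerSL K (ψ n) := by
      refine ContinuousLinearMap.ext_on hφ.dense_span ?_
      rintro _ ⟨k, rfl⟩
      simp only [ContinuousLinearMap.comp_apply, innerSL_apply_apply, smul_apply,
        hS.apply_eigenvector hA (hev k) ht, inner_smul_right, hψ k n, smul_eq_mul]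
      split_ifs with h
      · rw [h]
      · simp
    exact DFunLike.congr_fun this x

theorem IsDiagonalSemigroup.norm_apply_le (h : IsDiagonalSemigroup S ev φ ψ mR MR ω) {t : ℝ}
    (ht : 0 ≤ t) (x : H) : ‖S t x‖ ≤ √(MR / mR) * Real.exp (ω * t) * ‖x‖ := by
  have hb : ‖S t x‖ ^ 2 ≤ MR * (Real.exp (ω * t) ^ 2 * (‖x‖ ^ 2 / mR)) := by
    refine h.riesz.norm_sq_le_of_coeff h.biorth fun N => ?_
    have h1 : ∑ n ∈ Finset.range N, ‖inner K (ψ n) x‖ ^ 2 ≤ ‖x‖ ^ 2 / mR := by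
      rw [le_div_iff₀ h.riesz.lower_pos, mul_comm]; exact h.riesz.bessel h.biorth N x
    refine le_trans ?_ (mul_le_mul_of_nonneg_left h1 (by positivity))
    rw [Finset.mul_sum]
    refine Finset.sum_le_sum fun n _ => ?_
    rw [h.coeff n x t ht, norm_mul, mul_pow, norm_exp_smul_rclike]
    gcongr
    exact h.re_le n
  have h2 : MR * (Real.exp (ω * t) ^ 2 * (‖x‖ ^ 2 / mR))
      = (MR / mR) * (Real.exp (ω * t) * ‖x‖) ^ 2 := by ring
  rw [h2] at hb
  rw [mul_assoc, ← Real.sqrt_sq (by positivity : 0 ≤ Real.exp (ω * t) * ‖x‖),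
    ← Real.sqrt_mul' _ (by positivity)]
  exact Real.le_sqrt_of_sq_le hb

/-- `ω` is an admissible rate by `norm_apply_le`. Conversely, a rate `w < Re λ_n` fails on the orbit
of `φ n`, whose norm is `e^{Re λ_n t} ‖φ n‖`. -/
theorem IsDiagonalSemigroup.isGrowthBound (h : IsDiagonalSemigroup S ev φ ψ mR MR ω)
    (hω : IsLUB (range fun n => RCLike.re (ev n)) ω) : IsGrowthBound S ω := by
  refine ⟨?_, fun w hw => hw ⟨√(MR / mR), fun t ht =>
    ContinuousLinearMap.opNorm_le_bound _ (by positivity) fun x => h.norm_apply_le ht x⟩⟩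
  rintro w ⟨M, hM⟩
  refine hω.2 ?_
  rintro _ ⟨n, rfl⟩
  by_contra! hlt
  have hφ0 : ‖φ n‖ ≠ 0 := fun h0 => by
    have := h.biorth n n
    rw [norm_eq_zero.1 h0] at this
    simp at this
  have h1 : ∀ t : ℝ, 0 ≤ t → Real.exp (RCLike.re (ev n) * t) * ‖φ n‖
      ≤ M * Real.exp (w * t) * ‖φ n‖ := by
    intro t ht
    have h2 : S t (φ n) = NormedSpace.exp (t • ev n) • φ n := by
      refine h.riesz.ext_coeff h.biorth fun k => ?_
      rw [h.coeff k _ t ht, inner_smul_right, h.biorth n k]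
      split_ifs with hk
      · rw [hk]
      · simp
    have h3 := (S t).le_of_opNorm_le (hM t ht) (φ n)
    rw [h2, norm_smul, norm_exp_smul_rclike] at h3
    simpa using h3
  have h4 : Tendsto (fun t : ℝ => Real.exp ((RCLike.re (ev n) - w) * t)) atTop atTop :=
    Real.tendsto_exp_atTop.comp (tendsto_id.const_mul_atTop (sub_pos.2 hlt))
  obtain ⟨t, ht, ht0⟩ := ((h4.eventually_gt_atTop M).and (eventually_ge_atTop 0)).exists
  have h5 := h1 t ht0
  have h6 : Real.exp (RCLike.re (ev n) * t)
      = Real.exp ((RCLike.re (ev n) - w) * t) * Real.exp (w * t) := by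
    rw [← Real.exp_add]; ring_nf
  rw [h6] at h5
  have h7 := le_of_mul_le_mul_right h5 ((norm_nonneg _).lt_of_ne' hφ0)
  exact absurd (le_of_mul_le_mul_right h7 (Real.exp_pos _)) (not_le.2 ht)

/-- The coefficients of `A x` are `λ_n ⟨x, ψ_n⟩`. -/
theorem IsDiagonalSemigroup.coeff_generator (h : IsDiagonalSemigroup S ev φ ψ mR MR ω)
    (hA : IsGenerator S A) {x y : H} (hxy : (x, y) ∈ A.graph) (n : ℕ) :
    inner K (ψ n) y = ev n * inner K (ψ n) x := by
  -- The right derivative at 0 of `t ↦ ⟨S t x, ψ n⟩` is computed twice: from the generator, and from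
  -- the diagonal form.
  have h1 := ((innerSL K (ψ n)).continuous.tendsto _).comp ((hA x y).1 hxy)
  have h2 : HasDerivAt (fun t : ℝ => NormedSpace.exp (t • ev n) * inner K (ψ n) x)
      (ev n * inner K (ψ n) x) 0 := by
    simpa using (hasDerivAt_exp_smul (ev n) 0).mul_const (inner K (ψ n) x)
  have h3 := (hasDerivWithinAt_iff_tendsto_slope' self_notMem_Ioi).1
    (h2.hasDerivWithinAt (s := Ioi 0))
  refine tendsto_nhds_unique h1 (h3.congr' ?_)
  filter_upwards [self_mem_nhdsWithin] with t ht
  simp only [slope, Function.comp, innerSL_apply_apply, inner_smul_right, inner_sub_right,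
    h.coeff n x t (le_of_lt ht), vsub_eq_sub, zero_smul, NormedSpace.exp_zero, one_mul, sub_zero]
  rw [RCLike.real_smul_eq_coe_mul, RCLike.ofReal_inv]

theorem mem_graph_adjoint [CompleteSpace H] (hA : Dense (A.domain : Set H)) {y w : H}
    (h : ∀ x v : H, (x, v) ∈ A.graph → inner K w x = inner K y v) :
    (y, w) ∈ A.adjoint.graph := by
  have h' : ∀ x : A.domain, inner K w (x : H) = inner K y (A x) := fun x =>
    h _ _ (A.mem_graph x)
  rw [LinearPMap.mem_graph_iff]
  exact ⟨⟨y, LinearPMap.mem_adjoint_domain_of_exists y ⟨w, h'⟩⟩, rfl,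
    LinearPMap.adjoint_apply_eq hA _ h'⟩

theorem inner_eq_of_mem_graph_adjoint [CompleteSpace H] (hA : Dense (A.domain : Set H))
    {x v y w : H} (hy : (y, w) ∈ A.adjoint.graph) (hx : (x, v) ∈ A.graph) :
    inner K w x = inner K y v := by
  rw [LinearPMap.mem_graph_iff] at hy hx
  obtain ⟨y', rfl, rfl⟩ := hy
  obtain ⟨x', rfl, rfl⟩ := hx
  exact LinearPMap.adjoint_isFormalAdjoint hA y' x'

theorem IsRieszBasis.dense_domain (hφ : IsRieszBasis K φ mR MR)
    (hev : ∀ n, (φ n, ev n • φ n) ∈ A.graph) : Dense (A.domain : Set H) := by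
  refine hφ.dense_span.mono (Submodule.span_le.2 ?_)
  rintro _ ⟨n, rfl⟩
  exact LinearPMap.mem_domain_of_mem_graph (hev n)

/-- The vectors `ψ_n` are eigenvectors of the adjoint. -/
theorem IsDiagonalSemigroup.mem_graph_adjoint [CompleteSpace H]
    (h : IsDiagonalSemigroup S ev φ ψ mR MR ω) (hA : IsGenerator S A)
    (hd : Dense (A.domain : Set H)) (n : ℕ) :
    (ψ n, (starRingEnd K (ev n)) • ψ n) ∈ A.adjoint.graph :=
  RieszBCS.mem_graph_adjoint hd fun x v hxv => by
    rw [inner_smul_left, RCLike.conj_conj, h.coeff_generator hA hxv]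

theorem norm_ge_of_re_le {z : K} (hz : RCLike.re z ≤ ω) : -ω ≤ ‖z‖ := by
  have := (abs_le.1 (RCLike.abs_re_le_norm z)).1
  linarith

/-- A closed diagonal generator with spectral bound `ω < 0` is a bijection onto `H`. -/
theorem IsDiagonalSemigroup.existsUnique_preimage [CompleteSpace H]
    (h : IsDiagonalSemigroup S ev φ ψ mR MR ω) (hω : ω < 0) (hA : IsGenerator S A)
    (hcl : A.IsClosed) (hev : ∀ n, (φ n, ev n • φ n) ∈ A.graph) (y : H) :
    ∃! x : H, (x, y) ∈ A.graph := by
  have hne : ∀ n, ev n ≠ 0 := fun n h0 => by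
    have := norm_ge_of_re_le (h.re_le n)
    rw [h0, norm_zero] at this
    linarith
  -- The coefficients of the preimage must be `⟨y, ψ_n⟩ / λ_n`; they are square summable because
  -- `|λ_n| ≥ -ω > 0`.
  have hs : Summable fun n => ‖(ev n)⁻¹ * inner K (ψ n) y‖ ^ 2 := by
    refine Summable.of_nonneg_of_le (fun _ => by positivity) (fun n => ?_)
      ((h.riesz.summable_coeff h.biorth y).mul_left ((-ω)⁻¹ ^ 2))
    rw [norm_mul, mul_pow, norm_inv]
    gcongr
    · linarith
    · exact norm_ge_of_re_le (h.re_le n)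
  obtain ⟨x, hx⟩ := h.riesz.exists_coeff_eq h.biorth hs
  refine ⟨x, ?_, fun x' hx' => h.riesz.ext_coeff h.biorth fun n => ?_⟩
  -- `A` sends the partial sums of `x` to those of `y`; closedness of the graph gives the limit.
  · have h1 := (h.riesz.tendsto_partialSum h.biorth x).prodMk_nhds
      (h.riesz.tendsto_partialSum h.biorth y)
    refine IsClosed.mem_of_tendsto hcl h1 (Eventually.of_forall fun N => ?_)
    have : (partialSum K φ ψ N x, partialSum K φ ψ N y)
        = ∑ n ∈ Finset.range N, inner K (ψ n) x • (φ n, ev n • φ n) := by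
      refine Prod.ext ?_ ?_
      · simp only [Prod.fst_sum, Prod.smul_fst, partialSum_apply]
      · simp only [Prod.snd_sum, Prod.smul_snd, partialSum_apply]
        refine Finset.sum_congr rfl fun n _ => ?_
        rw [smul_smul, hx n, mul_comm, mul_inv_cancel_left₀ (hne n)]
    rw [this]
    exact Submodule.sum_mem _ fun n _ => Submodule.smul_mem _ _ (hev n)
  · rw [hx n, h.coeff_generator hA hx' n, inv_mul_cancel_left₀ (hne n)]

/-- The mild solution of `x' = A x + g`, `x 0 = X₀`. -/
def mildSolution [NormedSpace ℝ H] (S : ℝ → H →L[K] H) (X₀ : H) (g : ℝ → H) (t : ℝ) : H :=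
  S t X₀ + ∫ s in (0 : ℝ)..t, S (max (t - s) 0) (g s)

/-- Values of `S` at negative times are arbitrary, hence the truncation. Joint continuity follows
from continuity of orbits and the Lipschitz constant `√(MR/mR)`, uniform in time since `ω < 0`. -/
theorem IsDiagonalSemigroup.continuous_uncurry [CompleteSpace H]
    (h : IsDiagonalSemigroup S ev φ ψ mR MR ω) (hω : ω < 0) :
    Continuous fun p : ℝ × H => S (max p.1 0) p.2 := by
  refine continuous_prod_of_continuous_lipschitzWith' _ (Real.toNNReal √(MR / mR))
    (fun t => LipschitzWith.of_dist_le_mul fun x y => ?_) (fun x => ?_)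
  · rw [dist_eq_norm, ← map_sub, Real.coe_toNNReal _ (Real.sqrt_nonneg _), dist_eq_norm]
    refine (h.norm_apply_le (le_max_right _ _) _).trans ?_
    refine mul_le_mul_of_nonneg_right (mul_le_of_le_one_right (Real.sqrt_nonneg _) ?_)
      (norm_nonneg _)
    exact Real.exp_le_one_iff.2 (mul_nonpos_of_nonpos_of_nonneg hω.le (le_max_right _ _))
  · exact (h.c0.continuousOn_orbit x).comp_continuous (f := fun t : ℝ => max t 0) (by fun_prop)
      fun t => mem_Ici.2 (le_max_right _ _)

theorem IsDiagonalSemigroup.continuous_integrand [CompleteSpace H]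
    (h : IsDiagonalSemigroup S ev φ ψ mR MR ω) (hω : ω < 0) {g : ℝ → H}
    (hg : Continuous g) (t : ℝ) : Continuous fun s => S (max (t - s) 0) (g s) :=
  (h.continuous_uncurry hω).comp (f := fun s : ℝ => (t - s, g s)) (by fun_prop)

variable [NormedSpace ℝ H]

theorem IsDiagonalSemigroup.continuousOn_mildSolution [CompleteSpace H]
    (h : IsDiagonalSemigroup S ev φ ψ mR MR ω) (hω : ω < 0) (X₀ : H) {g : ℝ → H}
    (hg : Continuous g) : ContinuousOn (mildSolution S X₀ g) (Ici 0) := by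
  refine (h.c0.continuousOn_orbit X₀).add (Continuous.continuousOn ?_)
  refine intervalIntegral.continuous_parametric_intervalIntegral_of_continuous
    (f := fun t s => S (max (t - s) 0) (g s)) ?_ continuous_id
  exact (h.continuous_uncurry hω).comp
    (f := fun p : ℝ × ℝ => (p.1 - p.2, g p.2)) (by fun_prop)

theorem IsDiagonalSemigroup.coeff_mildSolution [CompleteSpace H]
    [IsScalarTower ℝ K H] (h : IsDiagonalSemigroup S ev φ ψ mR MR ω) (hω : ω < 0) (X₀ : H)
    {g : ℝ → H} (hg : Continuous g) {t : ℝ} (ht : 0 ≤ t) (n : ℕ) :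
    inner K (ψ n) (mildSolution S X₀ g t)
      = scalarMild (ev n) (inner K (ψ n) X₀) (fun s => inner K (ψ n) (g s)) 0 t := by
  rw [mildSolution, inner_add_right, h.coeff n X₀ t ht, scalarMild_eq]
  congr 1
  have h1 := (innerSL K (ψ n)).intervalIntegral_comp_comm
    ((h.continuous_integrand hω hg t).intervalIntegrable (μ := volume) 0 t)
  simp only [innerSL_apply_apply] at h1
  rw [← h1]
  refine intervalIntegral.integral_congr fun s hs => ?_
  rw [uIcc_of_le ht] at hs
  rw [max_eq_left (sub_nonneg.2 hs.2), h.coeff n _ _ (sub_nonneg.2 hs.2)]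

theorem IsDiagonalSemigroup.norm_mildSolution_le [CompleteSpace H]
    (h : IsDiagonalSemigroup S ev φ ψ mR MR ω) (hω : ω < 0) (X₀ : H)
    {g : ℝ → H} {t D : ℝ} (ht : 0 ≤ t) (hD : ∀ s ∈ Icc 0 t, ‖g s‖ ≤ D) :
    ‖mildSolution S X₀ g t‖
      ≤ √(MR / mR) * Real.exp (ω * t) * ‖X₀‖ + 1 / -ω * √(MR / mR) * D := by
  have hD0 : 0 ≤ D := (norm_nonneg _).trans (hD 0 ⟨le_rfl, ht⟩)
  refine (norm_add_le _ _).trans (add_le_add (h.norm_apply_le ht X₀) ?_)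
  have hc : Continuous fun s => √(MR / mR) * D * Real.exp (ω * (t - s)) := by fun_prop
  refine (intervalIntegral.norm_integral_le_of_norm_le ht (Eventually.of_forall fun s hs => ?_)
    (hc.intervalIntegrable 0 t)).trans ?_
  · have hs' : 0 ≤ t - s := sub_nonneg.2 hs.2
    rw [max_eq_left hs']
    refine (h.norm_apply_le hs' _).trans ?_
    rw [mul_right_comm]
    gcongr
    exact hD s ⟨hs.1.le, hs.2⟩
  · rw [intervalIntegral.integral_const_mul]
    calc _ ≤ √(MR / mR) * D * (1 / -ω) := by
          gcongr
          exact integral_exp_mul_sub_le hω t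
      _ = _ := by ring

end Diagonal

/-! ### The basis constant and the scalar estimate of the boundary input. -/

section Constants

variable {K H V : Type*} [RCLike K] [NormedAddCommGroup H] [InnerProductSpace K H]
  [NormedAddCommGroup V] [NormedSpace K V] {m : ℕ}

/-- The infimum defining `basisConst` is attained; the set of admissible constants is nonempty
because linear maps on a finite-dimensional space are bounded. -/
theorem norm_equivFun_le (E : Module.Basis (Fin m) K V) (v : V) :
    ‖E.equivFun v‖ ≤ basisConst E * ‖v‖ := by
  have : FiniteDimensional K V := E.finiteDimensional_of_finite
  rcases eq_or_ne v 0 with rfl | hv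
  · simp
  have hv' : 0 < ‖v‖ := norm_pos_iff.2 hv
  rw [← div_le_iff₀ hv']
  refine le_csInf ⟨‖LinearMap.toContinuousLinearMap E.equivFun.toLinearMap‖, fun v => ?_⟩
    fun c hc => (div_le_iff₀ hv').2 (hc v)
  exact (LinearMap.toContinuousLinearMap E.equivFun.toLinearMap).le_opNorm v

theorem basisConst_pos (hm : 0 < m) (E : Module.Basis (Fin m) K V) : 0 < basisConst E := by
  have h1 := norm_equivFun_le E (E ⟨0, hm⟩)
  have h2 : 0 < ‖E.equivFun (E ⟨0, hm⟩)‖ := norm_pos_iff.2 (by simp)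
  exact pos_of_mul_pos_left (h2.trans_le h1) (norm_nonneg _)

theorem le_supNorm {F : Type*} [NormedAddCommGroup F] {f : ℝ → F} (hf : ContinuousOn f (Ici 0))
    {s t : ℝ} (hs : s ∈ Icc 0 t) : ‖f s‖ ≤ supNorm f t :=
  le_csSup (isCompact_Icc.image_of_continuousOn
    (hf.mono Icc_subset_Ici_self).norm).bddAbove ⟨s, hs, rfl⟩

theorem one_le_dampingRatio {z : K} (hz : RCLike.re z < 0) : 1 ≤ dampingRatio z :=
  (one_le_div (abs_pos.2 hz.ne)).2 (RCLike.abs_re_le_norm z)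

/-- Here the damping ratio arises: the decay of the exponential, integrated to at most `1 / |Re z|`,
compensates the factor `z`. -/
theorem norm_scalarMild_boundary_le {z : K} (hz : RCLike.re z < 0) {h : ℝ → K} {t β : ℝ}
    (ht : 0 ≤ t) (hβ : ∀ s ∈ Icc 0 t, ‖h s‖ ≤ β) :
    ‖scalarMild z 0 (fun s => -(z * h s)) 0 t‖ ≤ dampingRatio z * β := by
  have hβ0 : 0 ≤ β := (norm_nonneg _).trans (hβ 0 ⟨le_rfl, ht⟩)
  rw [scalarMild_eq, mul_zero, zero_add]
  have hc : Continuous fun s => ‖z‖ * β * Real.exp (RCLike.re z * (t - s)) := by fun_prop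
  refine (intervalIntegral.norm_integral_le_of_norm_le ht (Eventually.of_forall fun s hs => ?_)
    (hc.intervalIntegrable 0 t)).trans ?_
  · rw [norm_mul, norm_neg, norm_mul, norm_exp_smul_rclike, mul_comm]
    gcongr
    exact hβ s ⟨hs.1.le, hs.2⟩
  · rw [intervalIntegral.integral_const_mul]
    calc _ ≤ ‖z‖ * β * (1 / -RCLike.re z) := by
          gcongr
          exact integral_exp_mul_sub_le hz t
      _ = _ := by rw [dampingRatio, abs_of_neg hz]; ring

theorem norm_inner_lifting_le (E : Module.Basis (Fin m) K V) (B : V →L[K] H) (y : H) {v : V}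
    {D : ℝ} (hv : ‖v‖ ≤ D) :
    ‖inner K y (B v)‖ ≤ ∑ k, (basisConst E * D) * ‖inner K y (B (E k))‖ := by
  have hD := (norm_equivFun_le E v)
  have hc : ∀ k, ‖E.equivFun v k‖ ≤ basisConst E * D := fun k => by
    have h1 := norm_le_pi_norm (E.equivFun v) k
    rcases eq_or_ne v 0 with rfl | h0
    · have : 0 ≤ basisConst E :=
        (basisConst_pos (Fin.pos_iff_nonempty.2 ⟨k⟩) E).le
      rw [norm_zero] at hv
      simpa using mul_nonneg this hv
    · have : 0 ≤ basisConst E :=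
        (basisConst_pos (Fin.pos_iff_nonempty.2 ⟨k⟩) E).le
      exact h1.trans (hD.trans (mul_le_mul_of_nonneg_left hv this))
  conv_lhs => rw [← E.sum_equivFun v, map_sum, _root_.inner_sum]
  refine (norm_sum_le _ _).trans (Finset.sum_le_sum fun k _ => ?_)
  rw [map_smul, inner_smul_right, norm_mul]
  gcongr
  exact hc k

/-- Cauchy–Schwarz over the `m` basis components, the origin of the factor `m` in `C₁`. -/
theorem sq_dampingRatio_mul_sum_le (ev : ℕ → K) (ψ : ℕ → H) (E : Module.Basis (Fin m) K V)
    (B : V →L[K] H) (c : ℝ) (n : ℕ) :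
    (dampingRatio (ev n) * ∑ k, c * ‖inner K (ψ n) (B (E k))‖) ^ 2
      ≤ c ^ 2 * (m * ∑ k, relaxedTerm ev ψ B (E k) n) := by
  have h1 := sq_sum_le_card_mul_sum_sq (s := Finset.univ)
    (f := fun k : Fin m => dampingRatio (ev n) * (c * ‖inner K (ψ n) (B (E k))‖))
  rw [Finset.card_univ, Fintype.card_fin, ← Finset.mul_sum] at h1
  refine h1.trans (le_of_eq ?_)
  rw [mul_left_comm, Finset.mul_sum (a := c ^ 2)]
  congr 1
  exact Finset.sum_congr rfl fun k _ => by rw [relaxedTerm]; ring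

theorem relaxedTerm_nonneg (ev : ℕ → K) (ψ : ℕ → H) (B : V →L[K] H) (e : V) (n : ℕ) :
    0 ≤ relaxedTerm ev ψ B e n := by
  unfold relaxedTerm; positivity

end Constants

/-! ### The boundary part of the solution, synthesised from its coefficients. -/

section BoundaryPart

variable {K H V : Type*} [RCLike K] [NormedAddCommGroup H] [InnerProductSpace K H]
  [NormedAddCommGroup V] [NormedSpace K V] {m : ℕ}
  {S : ℝ → H →L[K] H} {ev : ℕ → K} {φ ψ : ℕ → H} {mR MR ω : ℝ}

/-- The contribution of the boundary input to the solution. -/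
theorem IsDiagonalSemigroup.exists_boundaryPart [CompleteSpace H]
    (h : IsDiagonalSemigroup S ev φ ψ mR MR ω) (hω : ω < 0) (E : Module.Basis (Fin m) K V)
    (B : V →L[K] H) (hs : ∀ k, Summable (relaxedTerm ev ψ B (E k))) {d : ℝ → V}
    (hd : Continuous d) :
    ∃ Z : ℝ → H, ContinuousOn Z (Ici 0) ∧
      (∀ t, 0 ≤ t → ∀ n, inner K (ψ n) (Z t)
        = scalarMild (ev n) 0 (fun s => -(ev n * inner K (ψ n) (B (d s)))) 0 t) ∧
      ∀ t, 0 ≤ t → ∀ D : ℝ, (∀ s ∈ Icc 0 t, ‖d s‖ ≤ D) →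
        ‖Z t‖ ≤ |basisConst E * D| * √(m * MR * ∑ k, ∑' n, relaxedTerm ev ψ B (E k) n) := by
  set a : ℕ → ℝ → K :=
    fun n t => scalarMild (ev n) 0 (fun s => -(ev n * inner K (ψ n) (B (d s)))) 0 t with ha
  have hac : ∀ n, Continuous (a n) := fun n => continuous_scalarMild _ _ (by fun_prop) _
  -- A summable majorant of the squared coefficients that depends on time only through a bound `D`
  -- of `d`.
  set b : ℝ → ℕ → ℝ :=
    fun D n => (basisConst E * D) ^ 2 * (m * ∑ k, relaxedTerm ev ψ B (E k) n) with hb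
  have hbs : ∀ D, Summable (b D) := fun D =>
    ((summable_sum fun k _ => hs k).mul_left _).mul_left _
  have hab : ∀ t, 0 ≤ t → ∀ D : ℝ, (∀ s ∈ Icc 0 t, ‖d s‖ ≤ D) → ∀ n, ‖a n t‖ ^ 2 ≤ b D n := by
    intro t ht D hD n
    refine le_trans ?_ (sq_dampingRatio_mul_sum_le ev ψ E B _ n)
    refine pow_le_pow_left₀ (norm_nonneg _) ?_ 2
    exact norm_scalarMild_boundary_le ((h.re_le n).trans_lt hω) ht fun s hs =>
      norm_inner_lifting_le E B (ψ n) (hD s hs)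
  have hex : ∀ t : ℝ, ∃ D : ℝ, ∀ s ∈ Icc 0 t, ‖d s‖ ≤ D := fun t =>
    isCompact_Icc.exists_bound_of_continuousOn hd.continuousOn
  have hZ : ∀ t : ℝ, ∃ z : H, 0 ≤ t → ∀ n, inner K (ψ n) z = a n t := by
    intro t
    rcases le_or_gt 0 t with ht | ht
    · obtain ⟨D, hD⟩ := hex t
      obtain ⟨z, hz⟩ := h.riesz.exists_coeff_eq h.biorth (a := fun n => a n t)
        (Summable.of_nonneg_of_le (fun _ => by positivity) (hab t ht D hD) (hbs D))
      exact ⟨z, fun _ => hz⟩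
    · exact ⟨0, fun h => absurd h (not_le.2 ht)⟩
  choose Z hZ using hZ
  refine ⟨Z, ?_, hZ, ?_⟩
  · intro t ht
    -- Continuity is proved on `[0, t + 1]`, where one majorant serves all times; this interval is a
    -- neighbourhood of `t` in `[0, ∞)`.
    obtain ⟨D, hD⟩ := hex (t + 1)
    have hc : ContinuousOn Z (Icc 0 (t + 1)) := by
      refine h.riesz.continuousOn_of_coeff h.biorth (hbs D) (fun n r hr => ?_) (fun n => ?_)
      · rw [hZ r hr.1]
        exact hab r hr.1 D (fun s hs => hD s ⟨hs.1, hs.2.trans hr.2⟩) n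
      · exact (hac n).continuousOn.congr fun r hr => hZ r hr.1 n
    refine (hc t ⟨ht, by linarith⟩).mono_of_mem_nhdsWithin ?_
    rw [← Ici_inter_Iic]
    exact inter_mem self_mem_nhdsWithin (nhdsWithin_le_nhds (Iic_mem_nhds (by linarith)))
  · intro t ht D hD
    have h1 : ‖Z t‖ ^ 2 ≤ MR * ((basisConst E * D) ^ 2 *
        (m * ∑ k, ∑' n, relaxedTerm ev ψ B (E k) n)) := by
      refine h.riesz.norm_sq_le_of_coeff h.biorth fun N => ?_
      rw [← Summable.tsum_finsetSum fun k _ => hs k, ← tsum_mul_left, ← tsum_mul_left]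
      refine le_trans (Finset.sum_le_sum fun n _ => ?_) ((hbs D).sum_le_tsum _ fun n _ => ?_)
      · rw [hZ t ht n]
        exact hab t ht D hD n
      · exact mul_nonneg (by positivity) (mul_nonneg (by positivity)
          (Finset.sum_nonneg fun k _ => relaxedTerm_nonneg ev ψ B (E k) n))
    rw [← Real.sqrt_sq_eq_abs, ← Real.sqrt_mul (by positivity)]
    refine Real.le_sqrt_of_sq_le (h1.trans (le_of_eq ?_))
    ring

end BoundaryPart

/-! ### Comparison of lifting operators; test functions. -/

section Liftings

variable {K H V : Type*} [RCLike K] [NormedAddCommGroup H] [InnerProductSpace K H]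
  [NormedAddCommGroup V] [NormedSpace K V] {A : H →ₗ.[K] H} {Bd : H →ₗ.[K] V}

/-- Two liftings differ by an operator with values in the domain of `𝒜₀`. -/
theorem IsLifting.sub_mem_graph {B AB B' AB' : V →L[K] H} (h : IsLifting A Bd B AB)
    (h' : IsLifting A Bd B' AB') (v : V) :
    (B' v - B v, AB' v - AB v) ∈ (disturbanceFree A Bd).graph := by
  rw [mem_graph_disturbanceFree]
  refine ⟨A.graph.sub_mem (h'.op v) (h.op v), ?_⟩
  simpa using Bd.graph.sub_mem (h'.bdry v) (h.bdry v)

theorem IsTestFunction.continuousOn [NormedSpace ℝ H] {adj : H →ₗ.[K] H} {T : ℝ} {z z' w : ℝ → H}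
    (hz : IsTestFunction adj T z z' w) : ContinuousOn z (Icc 0 T) :=
  fun t ht => (hz.hasDeriv t ht).continuousWithinAt

end Liftings

/-! ### Weak solutions: the projected equations, uniqueness and existence. -/

section Weak

variable {K H V : Type*} [RCLike K] [NormedAddCommGroup H] [InnerProductSpace K H]
  [CompleteSpace H] [NormedSpace ℝ H] [IsScalarTower ℝ K H]
  [NormedAddCommGroup V] [NormedSpace K V] {m : ℕ}
  {S : ℝ → H →L[K] H} {A₀ : H →ₗ.[K] H} {ev : ℕ → K} {φ ψ : ℕ → H} {mR MR ω : ℝ}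

omit [IsScalarTower ℝ K H] in
-- Since `⟨x, w⟩ = λ ⟨x, z⟩` by adjointness, the integrand is the derivative of `c t * ⟨x, z t⟩`,
-- which vanishes at `T`.
theorem integral_coeff_testFunction {T : ℝ} (hT : 0 < T) {z z' w : ℝ → H}
    (hd : Dense (A₀.domain : Set H)) (hz : IsTestFunction A₀.adjoint T z z' w)
    {lam : K} {x : H} (hx : (x, lam • x) ∈ A₀.graph) {c β γ : ℝ → K}
    (hc : ∀ t, HasDerivAt c (lam * c t + (γ t - lam * β t)) t)
    (hβ : Continuous β) (hγ : Continuous γ) :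
    ∫ t in (0 : ℝ)..T, (c t * inner K (w t + z' t) x + γ t * inner K (z t) x
        - β t * inner K (w t) x) = -(c 0 * inner K (z 0) x) := by
  have hcc : Continuous c := continuous_iff_continuousAt.2 fun t => (hc t).continuousAt
  have hzc := hz.continuousOn
  have hz'c := hz.continuousOn_deriv
  have hwc := hz.continuousOn_adjoint
  have h1 : ContinuousOn (fun t => c t * inner K (z t) x) (Icc 0 T) :=
    hcc.continuousOn.mul (hzc.inner continuousOn_const)
  have h2 : ContinuousOn (fun t => c t * inner K (w t + z' t) x + γ t * inner K (z t) x
        - β t * inner K (w t) x) (Icc 0 T) :=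
    ((hcc.continuousOn.mul ((hwc.add hz'c).inner continuousOn_const)).add
      (hγ.continuousOn.mul (hzc.inner continuousOn_const))).sub
      (hβ.continuousOn.mul (hwc.inner continuousOn_const))
  rw [intervalIntegral.integral_eq_sub_of_hasDerivAt_of_le hT.le h1 (fun t ht => ?_)
    (h2.intervalIntegrable_of_Icc hT.le)]
  · simp [hz.terminal]
  · have ht' := Ioo_subset_Icc_self ht
    have h3 : HasDerivAt z (z' t) t := (hz.hasDeriv t ht').hasDerivAt (Icc_mem_nhds ht.1 ht.2)
    have h4 := (hc t).mul (h3.inner K (hasDerivAt_const t x))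
    refine h4.congr_deriv ?_
    have h5 := inner_eq_of_mem_graph_adjoint hd (hz.mem_adjoint t ht') hx
    rw [inner_smul_right] at h5
    rw [inner_zero_right, zero_add, inner_add_left, h5]
    ring

omit [IsScalarTower ℝ K H] in
/-- A function whose coefficients solve the projected equations satisfies the weak equation. -/
theorem weak_equation_of_coeff (hφ : IsRieszBasis K φ mR MR) (hψ : IsBiorthogonal K φ ψ)
    (hev : ∀ n, (φ n, ev n • φ n) ∈ A₀.graph) {X g b : ℝ → H} {X₀ : H} {c : ℕ → ℝ → K}
    (hX : ContinuousOn X (Ici 0)) (hg : Continuous g) (hb : Continuous b)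
    (hcX : ∀ t, 0 ≤ t → ∀ n, inner K (ψ n) (X t) = c n t)
    (hc : ∀ n t, HasDerivAt (c n)
      (ev n * c n t + (inner K (ψ n) (g t) - ev n * inner K (ψ n) (b t))) t)
    (hc0 : ∀ n, c n 0 = inner K (ψ n) X₀)
    {T : ℝ} (hT : 0 < T) {z z' w : ℝ → H} (hz : IsTestFunction A₀.adjoint T z z' w) :
    ∫ t in (0 : ℝ)..T, (inner K (w t + z' t) (X t) + inner K (z t) (g t)
        - inner K (w t) (b t)) = -inner K (z 0) X₀ := by
  have hd := hφ.dense_domain hev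
  have hzc := hz.continuousOn
  have hwc := hz.continuousOn_adjoint
  have hwz := hwc.add hz.continuousOn_deriv
  have hXc := hX.mono (Icc_subset_Ici_self : Icc 0 T ⊆ _)
  set P := partialSum K φ ψ with hP
  have hin : ∀ N (y x : H), inner K y (P N x)
      = ∑ n ∈ Finset.range N, inner K (ψ n) x * inner K y (φ n) := by
    intro N y x
    rw [hP, partialSum_apply, _root_.inner_sum]
    exact Finset.sum_congr rfl fun n _ => by rw [inner_smul_right]
  have hcc : ∀ n, Continuous (c n) := fun n =>
    continuous_iff_continuousAt.2 fun t => (hc n t).continuousAt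
  -- The projected weak equation, a finite sum of the scalar identities.
  have hN : ∀ N, ∫ t in (0 : ℝ)..T, (inner K (w t + z' t) (P N (X t)) + inner K (z t) (P N (g t))
        - inner K (w t) (P N (b t))) = -inner K (z 0) (P N X₀) := by
    intro N
    rw [hin, ← Finset.sum_neg_distrib]
    have h1 : ∀ n ∈ Finset.range N, -(inner K (ψ n) X₀ * inner K (z 0) (φ n))
        = ∫ t in (0 : ℝ)..T, (c n t * inner K (w t + z' t) (φ n)
          + inner K (ψ n) (g t) * inner K (z t) (φ n)
          - inner K (ψ n) (b t) * inner K (w t) (φ n)) := fun n _ => by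
      rw [integral_coeff_testFunction hT hd hz (hev n) (hc n) (by fun_prop) (by fun_prop), hc0]
    rw [Finset.sum_congr rfl h1, ← intervalIntegral.integral_finsetSum]
    · refine intervalIntegral.integral_congr fun t ht => ?_
      rw [uIcc_of_le hT.le] at ht
      simp only [hin, hcX t ht.1, ← Finset.sum_add_distrib, ← Finset.sum_sub_distrib]
    · intro n _
      refine ContinuousOn.intervalIntegrable_of_Icc hT.le ?_
      exact (((hcc n).continuousOn.mul (hwz.inner continuousOn_const)).add
        ((continuousOn_const.inner hg.continuousOn).mul (hzc.inner continuousOn_const))).sub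
        ((continuousOn_const.inner hb.continuousOn).mul (hwc.inner continuousOn_const))
  have hL : Tendsto (fun N => -inner K (z 0) (P N X₀)) atTop (𝓝 (-inner K (z 0) X₀)) :=
    (tendsto_const_nhds.inner (hφ.tendsto_partialSum hψ X₀)).neg
  set C := √(MR / mR)
  refine tendsto_nhds_unique ?_ hL
  simp only [← hN]
  -- The projections converge pointwise and are bounded by `C` uniformly in `N`, which supplies the
  -- dominating function.
  refine intervalIntegral.tendsto_integral_filter_of_dominated_convergence
    (fun t => ‖w t + z' t‖ * (C * ‖X t‖) + ‖z t‖ * (C * ‖g t‖) + ‖w t‖ * (C * ‖b t‖))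
    (Eventually.of_forall fun N => ?_) (Eventually.of_forall fun N => ?_) ?_ ?_
  · rw [uIoc_of_le hT.le]
    refine ContinuousOn.aestronglyMeasurable ?_ measurableSet_Ioc
    refine ContinuousOn.mono ?_ Ioc_subset_Icc_self
    exact ((hwz.inner ((P N).continuous.comp_continuousOn hXc)).add
      (hzc.inner ((P N).continuous.comp_continuousOn hg.continuousOn))).sub
      (hwc.inner ((P N).continuous.comp_continuousOn hb.continuousOn))
  · have hPN : ∀ y x : H, ‖inner K y (P N x)‖ ≤ ‖y‖ * (C * ‖x‖) := fun y x =>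
      (norm_inner_le_norm _ _).trans
        (mul_le_mul_of_nonneg_left (hφ.norm_partialSum_le hψ N x) (norm_nonneg _))
    refine Eventually.of_forall fun t _ => (norm_sub_le _ _).trans (add_le_add ?_ (hPN _ _))
    exact (norm_add_le _ _).trans (add_le_add (hPN _ _) (hPN _ _))
  · refine ContinuousOn.intervalIntegrable_of_Icc hT.le ?_
    exact ((hwz.norm.mul (continuousOn_const.mul hXc.norm)).add
      (hzc.norm.mul (continuousOn_const.mul hg.continuousOn.norm))).add
      (hwc.norm.mul (continuousOn_const.mul hb.continuousOn.norm))
  · refine Eventually.of_forall fun t _ => ?_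
    exact ((tendsto_const_nhds.inner (hφ.tendsto_partialSum hψ _)).add
      (tendsto_const_nhds.inner (hφ.tendsto_partialSum hψ _))).sub
      (tendsto_const_nhds.inner (hφ.tendsto_partialSum hψ _))

variable {A : H →ₗ.[K] H} {Bd : H →ₗ.[K] V}

/-- For the difference of two solutions with coefficient `q = ⟨Y - X, ψ_n⟩`, a test function with
`𝒜₀* z + z' = q ψ_n` turns the weak equation into `∫ |q|² = 0`. -/
theorem IsWeakSolution.eqOn (hφ : IsRieszBasis K φ mR MR) (hψ : IsBiorthogonal K φ ψ)
    (hψA : ∀ n, (ψ n, (starRingEnd K (ev n)) • ψ n) ∈ (disturbanceFree A Bd).adjoint.graph)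
    (hlift : ∃ B AB : V →L[K] H, IsLifting A Bd B AB) {X₀ : H} {d : ℝ → V} {U X Y : ℝ → H}
    (hX : IsWeakSolution A Bd X₀ d U X) (hY : IsWeakSolution A Bd X₀ d U Y) :
    EqOn Y X (Ici 0) := by
  obtain ⟨B, AB, hB⟩ := hlift
  have key : ∀ n, ∀ T : ℝ, 0 < T → ∀ s ∈ Icc 0 T, inner K (ψ n) (Y s - X s) = 0 := by
    intro n T hT
    have hmax : Continuous fun t : ℝ => max t 0 := by fun_prop
    have hmem : ∀ t : ℝ, max t 0 ∈ Ici (0 : ℝ) := fun t => mem_Ici.2 (le_max_right _ _)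
    set q : ℝ → K := fun t => inner K (ψ n) (Y (max t 0) - X (max t 0)) with hq
    have hqc : Continuous q := continuous_const.inner
      ((hY.continuousOn.comp_continuous hmax hmem).sub
        (hX.continuousOn.comp_continuous hmax hmem))
    -- Solves `f' = -conj(λ_n) f + q` with `f T = 0`; as `𝒜₀* ψ_n = conj(λ_n) ψ_n`, the test
    -- function `f ψ_n` has the required image.
    set f := scalarMild (-(starRingEnd K (ev n))) 0 q T with hf
    have hfd := hasDerivAt_scalarMild (-(starRingEnd K (ev n))) 0 hqc T
    have hfc : Continuous f := continuous_scalarMild _ _ hqc _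
    have htest : IsTestFunction (disturbanceFree A Bd).adjoint T (fun t => f t • ψ n)
        (fun t => (-(starRingEnd K (ev n)) * f t + q t) • ψ n)
        (fun t => f t • (starRingEnd K (ev n)) • ψ n) := by
      refine ⟨fun t _ => ((hfd t).smul_const (ψ n)).hasDerivWithinAt,
        Continuous.continuousOn (by fun_prop),
        fun t _ => Submodule.smul_mem _ (f t) (hψA n), Continuous.continuousOn (by fun_prop), ?_⟩
      simp only [hf, scalarMild_self, zero_smul]
    have h1 := (hY.weak B AB hB T hT _ _ _ htest).trans (hX.weak B AB hB T hT _ _ _ htest).symm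
    have h2 : ∀ t, f t • (starRingEnd K (ev n)) • ψ n
        + (-(starRingEnd K (ev n)) * f t + q t) • ψ n = q t • ψ n := fun t => by
      rw [smul_smul, ← add_smul]; congr 1; ring
    simp only [h2] at h1
    have hc : ∀ {W : ℝ → H}, ContinuousOn W (Ici 0) →
        IntervalIntegrable (fun t => inner K (q t • ψ n) (W t)) volume 0 T := fun hW =>
      ContinuousOn.intervalIntegrable_of_Icc hT.le
        (Continuous.continuousOn (by fun_prop) |>.inner (hW.mono Icc_subset_Ici_self))
    rw [← sub_eq_zero, ← intervalIntegral.integral_sub (hc hY.continuousOn)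
      (hc hX.continuousOn)] at h1
    have h3 : ∫ t in (0 : ℝ)..T, ‖q t‖ ^ 2 = 0 := by
      have h4 : ∫ t in (0 : ℝ)..T, ((‖q t‖ ^ 2 : ℝ) : K) = 0 := by
        rw [← h1]
        refine intervalIntegral.integral_congr fun t ht => ?_
        rw [uIcc_of_le hT.le] at ht
        rw [← inner_sub_right, inner_smul_left]
        have : inner K (ψ n) (Y t - X t) = q t := by simp only [hq, max_eq_left ht.1]
        rw [this, RCLike.conj_mul]
        push_cast
        rfl
      rw [RCLike.intervalIntegral_ofReal] at h4
      exact_mod_cast h4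
    intro s hs
    by_contra hne
    have hpos : 0 < ∫ t in (0 : ℝ)..T, ‖q t‖ ^ 2 := by
      refine intervalIntegral.integral_pos hT (by fun_prop) (fun _ _ => by positivity)
        ⟨s, hs, ?_⟩
      have : q s ≠ 0 := by simpa only [hq, max_eq_left hs.1] using hne
      positivity
    exact hpos.ne' h3
  intro t ht
  refine hφ.ext_coeff hψ fun n => ?_
  rw [← sub_eq_zero, ← inner_sub_right]
  exact key n (t + 1) (by linarith [mem_Ici.1 ht]) t ⟨ht, by linarith⟩

theorem exists_weakSolution (h : IsDiagonalSemigroup S ev φ ψ mR MR ω) (hω : ω < 0)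
    (hev : ∀ n, (φ n, ev n • φ n) ∈ (disturbanceFree A Bd).graph) (hm : 0 < m)
    (E : Module.Basis (Fin m) K V) {B AB : V →L[K] H} (hB : IsLifting A Bd B AB)
    (hs : ∀ k, Summable (relaxedTerm ev ψ B (E k))) (X₀ : H) {d : ℝ → V} {U : ℝ → H}
    (hd : ContinuousOn d (Ici 0)) (hU : ContinuousOn U (Ici 0)) :
    ∃ X : ℝ → H, IsWeakSolution A Bd X₀ d U X ∧ ∀ t : ℝ, 0 ≤ t →
      ‖X t‖ ≤ √(MR / mR) * Real.exp (-(-ω) * t) * ‖X₀‖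
        + C1Relaxed (-ω) mR MR E B AB ev ψ * supNorm d t
        + 1 / (-ω) * √(MR / mR) * supNorm U t := by
  have hmax : Continuous fun t : ℝ => max t 0 := by fun_prop
  have hmem : ∀ t : ℝ, max t 0 ∈ Ici (0 : ℝ) := fun t => mem_Ici.2 (le_max_right _ _)
  -- Inputs are frozen at their initial value for negative times, which makes them continuous on all
  -- of `ℝ`.
  set d' : ℝ → V := fun t => d (max t 0) with hd'
  set U' : ℝ → H := fun t => U (max t 0) with hU'
  have hdc : Continuous d' := hd.comp_continuous hmax hmem
  have hUc : Continuous U' := hU.comp_continuous hmax hmem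
  have hdd : ∀ t, 0 ≤ t → d' t = d t := fun t ht => by simp only [hd', max_eq_left ht]
  have hUU : ∀ t, 0 ≤ t → U' t = U t := fun t ht => by simp only [hU', max_eq_left ht]
  obtain ⟨Z, hZc, hZ, hZb⟩ := h.exists_boundaryPart hω E B hs hdc
  set g : ℝ → H := fun t => AB (d' t) + U' t with hg
  have hgc : Continuous g := by fun_prop
  have hbc : Continuous fun t => B (d' t) := by fun_prop
  refine ⟨fun t => mildSolution S X₀ g t + Z t, ⟨?_, ?_⟩, ?_⟩
  · exact (h.continuousOn_mildSolution hω X₀ hgc).add hZc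
  · intro B' AB' hB' T hT z z' w hz
    have hdense := h.riesz.dense_domain hev
    have hX := (h.continuousOn_mildSolution hω X₀ hgc).add hZc
    have key := weak_equation_of_coeff (A₀ := disturbanceFree A Bd) h.riesz h.biorth hev
      (X := fun t => mildSolution S X₀ g t + Z t) (g := g) (b := fun t => B (d' t)) (X₀ := X₀)
      (c := fun n t => scalarMild (ev n) (inner K (ψ n) X₀) (fun s => inner K (ψ n) (g s)) 0 t
        + scalarMild (ev n) 0 (fun s => -(ev n * inner K (ψ n) (B (d' s)))) 0 t)
      hX hgc hbc
      (fun t ht n => by rw [inner_add_right, h.coeff_mildSolution hω X₀ hgc ht, hZ t ht])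
      (fun n t => by
        refine ((hasDerivAt_scalarMild _ _ (by fun_prop) 0 t).add
          (hasDerivAt_scalarMild _ _ (by fun_prop) 0 t)).congr_deriv ?_
        ring)
      (fun n => by simp only [scalarMild_self, add_zero]) hT hz
    have hzc := hz.continuousOn
    have hwc := hz.continuousOn_adjoint
    have hd0 := hd.mono (Icc_subset_Ici_self : Icc 0 T ⊆ _)
    have hU0 := hU.mono (Icc_subset_Ici_self : Icc 0 T ⊆ _)
    have i1 : IntervalIntegrable
        (fun t => inner K (w t + z' t) (mildSolution S X₀ g t + Z t)) volume 0 T :=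
      ContinuousOn.intervalIntegrable_of_Icc hT.le
        ((hwc.add hz.continuousOn_deriv).inner (hX.mono Icc_subset_Ici_self))
    have i2 : IntervalIntegrable (fun t => inner K (z t) (AB' (d t))) volume 0 T :=
      ContinuousOn.intervalIntegrable_of_Icc hT.le
        (hzc.inner (AB'.continuous.comp_continuousOn hd0))
    have i3 : IntervalIntegrable (fun t => inner K (z t) (U t)) volume 0 T :=
      ContinuousOn.intervalIntegrable_of_Icc hT.le (hzc.inner hU0)
    have i4 : IntervalIntegrable (fun t => inner K (w t) (B' (d t))) volume 0 T :=
      ContinuousOn.intervalIntegrable_of_Icc hT.le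
        (hwc.inner (B'.continuous.comp_continuousOn hd0))
    -- The solution is built from `B`, but the weak equation is required for every lifting `B'`. As
    -- `B' - B` maps into `D(𝒜₀)`, adjointness moves `𝒜₀*` across and the discrepancies of the two
    -- lifting terms cancel.
    have hcongr : ∫ t in (0 : ℝ)..T, (inner K (w t + z' t) (mildSolution S X₀ g t + Z t)
          + inner K (z t) (g t) - inner K (w t) (B (d' t)))
        = ∫ t in (0 : ℝ)..T, (inner K (w t + z' t) (mildSolution S X₀ g t + Z t)
          + (inner K (z t) (AB' (d t)) + inner K (z t) (U t)) - inner K (w t) (B' (d t))) := by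
      refine intervalIntegral.integral_congr fun t ht => ?_
      rw [uIcc_of_le hT.le] at ht
      have h1 := inner_eq_of_mem_graph_adjoint hdense (hz.mem_adjoint t ht)
        (hB.sub_mem_graph hB' (d t))
      rw [inner_sub_right, inner_sub_right] at h1
      simp only [hg, hdd t ht.1, hUU t ht.1, inner_add_right (z t)]
      linear_combination h1
    rw [hcongr, intervalIntegral.integral_sub (i1.add (i2.add i3)) i4,
      intervalIntegral.integral_add i1 (i2.add i3), intervalIntegral.integral_add i2 i3] at key
    linear_combination key
  · intro t ht
    have hDd : ∀ s ∈ Icc 0 t, ‖d' s‖ ≤ supNorm d t := fun s hs => by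
      rw [hdd s hs.1]; exact le_supNorm hd hs
    have hDg : ∀ s ∈ Icc 0 t, ‖g s‖ ≤ ‖AB‖ * supNorm d t + supNorm U t := fun s hs => by
      refine (norm_add_le _ _).trans (add_le_add (AB.le_opNorm_of_le (hDd s hs)) ?_)
      rw [hUU s hs.1]; exact le_supNorm hU hs
    have hd0 : 0 ≤ supNorm d t := (norm_nonneg _).trans (hDd 0 ⟨le_rfl, ht⟩)
    have h1 := h.norm_mildSolution_le hω X₀ ht hDg
    have h2 := hZb t ht _ hDd
    rw [abs_of_nonneg (mul_nonneg (basisConst_pos hm E).le hd0)] at h2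
    refine (norm_add_le _ _).trans ((add_le_add h1 h2).trans (le_of_eq ?_))
    rw [C1Relaxed, neg_neg]
    ring

end Weak

/-! ### Stationary states, independence of the lifting, comparison of the constants. -/

section Main

variable {K H V : Type*} [RCLike K] [NormedAddCommGroup H] [InnerProductSpace K H]
  [CompleteSpace H] [NormedAddCommGroup V] [NormedSpace K V] {m : ℕ}
  {S : ℝ → H →L[K] H} {A : H →ₗ.[K] H} {Bd : H →ₗ.[K] V} {ev : ℕ → K} {φ ψ : ℕ → H}
  {mR MR ω : ℝ}

/-- The state is `B e + y` with `𝒜₀ y = -𝒜B e`; bijectivity of `𝒜₀` gives existence and uniqueness.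
-/
theorem IsDiagonalSemigroup.existsUnique_stationaryState
    (h : IsDiagonalSemigroup S ev φ ψ mR MR ω) (hω : ω < 0)
    (hA : IsGenerator S (disturbanceFree A Bd)) (hcl : (disturbanceFree A Bd).IsClosed)
    (hev : ∀ n, (φ n, ev n • φ n) ∈ (disturbanceFree A Bd).graph) {B AB : V →L[K] H}
    (hB : IsLifting A Bd B AB) (e : V) : ∃! x : H, IsStationaryState A Bd e x := by
  obtain ⟨y, hy, -⟩ := h.existsUnique_preimage hω hA hcl hev (-AB e)
  rw [mem_graph_disturbanceFree] at hy
  have hx : IsStationaryState A Bd e (B e + y) := by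
    constructor
    · simpa using A.graph.add_mem (hB.op e) hy.1
    · simpa using Bd.graph.add_mem (hB.bdry e) hy.2
  refine ⟨B e + y, hx, fun x' hx' => ?_⟩
  have hsub : (x' - (B e + y), (0 : H)) ∈ (disturbanceFree A Bd).graph := by
    rw [mem_graph_disturbanceFree]
    constructor
    · simpa using A.graph.sub_mem hx'.1 hx.1
    · simpa using Bd.graph.sub_mem hx'.2 hx.2
  exact sub_eq_zero.1 ((h.existsUnique_preimage hω hA hcl hev 0).unique hsub
    (disturbanceFree A Bd).graph.zero_mem)

omit [CompleteSpace H] in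
/-- The summability condition does not depend on the lifting operator nor on the basis. -/
theorem IsDiagonalSemigroup.summable_relaxedTerm
    (h : IsDiagonalSemigroup S ev φ ψ mR MR ω) (hω : ω < 0)
    (hA : IsGenerator S (disturbanceFree A Bd)) (hR : RelaxedDamping A Bd m ev ψ)
    {B AB : V →L[K] H} (hB : IsLifting A Bd B AB) (v : V) :
    Summable (relaxedTerm ev ψ B v) := by
  obtain ⟨B', AB', hB', E, hE⟩ := hR
  have h1 : Summable (relaxedTerm ev ψ B' v) := by
    refine Summable.of_nonneg_of_le (relaxedTerm_nonneg ev ψ B' v) (fun n => ?_)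
      (((summable_sum (s := Finset.univ) fun k _ => hE k).mul_left (m : ℝ)).mul_left ((basisConst E * ‖v‖) ^ 2))
    refine le_trans ?_ (sq_dampingRatio_mul_sum_le ev ψ E B' _ n)
    rw [relaxedTerm, ← mul_pow]
    have : 0 ≤ dampingRatio (ev n) := by unfold dampingRatio; positivity
    gcongr
    exact norm_inner_lifting_le E B' (ψ n) le_rfl
  refine Summable.of_nonneg_of_le (relaxedTerm_nonneg ev ψ B v) (fun n => ?_)
    ((h1.mul_left 2).add
      ((h.riesz.summable_coeff h.biorth (AB v - AB' v)).mul_left (2 * (-ω)⁻¹ ^ 2)))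
  have hc := h.coeff_generator hA (hB'.sub_mem_graph hB v) n
  have hre := h.re_le n
  -- On `D(𝒜₀)` the numerator `|λ_n|` is absorbed by `𝒜₀`, leaving `1 / |Re λ_n| ≤ 1 / (-ω)` times a
  -- coefficient of `𝒜B v - 𝒜B' v`, which is square summable.
  have hratio : dampingRatio (ev n) * ‖inner K (ψ n) (B v - B' v)‖
      ≤ (-ω)⁻¹ * ‖inner K (ψ n) (AB v - AB' v)‖ := by
    rw [hc, norm_mul, dampingRatio, abs_of_neg (hre.trans_lt hω), div_eq_inv_mul, mul_assoc]
    gcongr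
    linarith
  have h0 : 0 ≤ dampingRatio (ev n) := by unfold dampingRatio; positivity
  have htri : ‖inner K (ψ n) (B v)‖ ≤ ‖inner K (ψ n) (B' v)‖ + ‖inner K (ψ n) (B v - B' v)‖ := by
    rw [inner_sub_right]
    exact norm_le_norm_add_norm_sub' _ _
  have h2 : dampingRatio (ev n) * ‖inner K (ψ n) (B v)‖
      ≤ dampingRatio (ev n) * ‖inner K (ψ n) (B' v)‖
        + (-ω)⁻¹ * ‖inner K (ψ n) (AB v - AB' v)‖ := by
    refine (mul_le_mul_of_nonneg_left htri h0).trans ?_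
    rw [mul_add]
    gcongr
  calc relaxedTerm ev ψ B v n
      = (dampingRatio (ev n) * ‖inner K (ψ n) (B v)‖) ^ 2 := by rw [relaxedTerm, mul_pow]
    _ ≤ _ := pow_le_pow_left₀ (by positivity) h2 2
    _ ≤ _ := add_sq_le
    _ = _ := by rw [relaxedTerm]; ring

omit [CompleteSpace H] in
theorem IsLifting.apply_ne_zero {B AB : V →L[K] H} (hB : IsLifting A Bd B AB) {v : V}
    (hv : v ≠ 0) : B v ≠ 0 := fun h0 => hv <| by
  have := hB.bdry v
  rw [h0] at this
  exact Bd.graph_fst_eq_zero_snd this rfl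

omit [CompleteSpace H] in
-- `ℬ B = I` forces `B (E k) ≠ 0`, so one of its coefficients is nonzero and the series is positive.
theorem IsDiagonalSemigroup.C1Relaxed_pos (h : IsDiagonalSemigroup S ev φ ψ mR MR ω)
    (hω : ω < 0) (hm : 0 < m) (E : Module.Basis (Fin m) K V) {B AB : V →L[K] H}
    (hB : IsLifting A Bd B AB) (hs : ∀ k, Summable (relaxedTerm ev ψ B (E k))) :
    0 < C1Relaxed (-ω) mR MR E B AB ev ψ := by
  have hω' : 0 < -ω := neg_pos.2 hω
  have hpos : ∀ k, 0 < ∑' n, relaxedTerm ev ψ B (E k) n := fun k => by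
    obtain ⟨n, hn⟩ : ∃ n, inner K (ψ n) (B (E k)) ≠ 0 := by
      by_contra! hcon
      exact hB.apply_ne_zero (E.ne_zero k) (h.riesz.eq_zero_of_coeff h.biorth hcon)
    refine (hs k).tsum_pos (relaxedTerm_nonneg ev ψ B (E k)) n ?_
    have h1 := one_le_dampingRatio ((h.re_le n).trans_lt hω)
    have h2 : 0 < dampingRatio (ev n) := by linarith
    unfold relaxedTerm
    positivity
  have hsum : 0 < ∑ k, ∑' n, relaxedTerm ev ψ B (E k) n :=
    Finset.sum_pos (fun k _ => hpos k) ⟨⟨0, hm⟩, Finset.mem_univ _⟩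
  have hc := basisConst_pos hm E
  have hMR := h.riesz.upper_pos
  have hm' : (0 : ℝ) < m := by exact_mod_cast hm
  unfold C1Relaxed
  positivity

omit [CompleteSpace H] in
theorem relaxedTerm_le {ζ : ℝ} (hζ : ∀ n, dampingRatio (ev n) ≤ ζ) (B : V →L[K] H) (v : V) (n : ℕ) :
    relaxedTerm ev ψ B v n ≤ ζ ^ 2 * ‖inner K (ψ n) (B v)‖ ^ 2 := by
  have : 0 ≤ dampingRatio (ev n) := by unfold dampingRatio; positivity
  unfold relaxedTerm
  gcongr
  exact hζ n

omit [CompleteSpace H] in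
theorem IsDiagonalSemigroup.summable_relaxedTerm_of_dampingRatio_le
    (h : IsDiagonalSemigroup S ev φ ψ mR MR ω) {ζ : ℝ} (hζ : ∀ n, dampingRatio (ev n) ≤ ζ)
    (B : V →L[K] H) (v : V) : Summable (relaxedTerm ev ψ B v) :=
  Summable.of_nonneg_of_le (relaxedTerm_nonneg ev ψ B v) (relaxedTerm_le hζ B v)
    ((h.riesz.summable_coeff h.biorth (B v)).mul_left _)

omit [CompleteSpace H] in
-- Case (a) from case (b): the ratio is at most `ζ`, and Bessel's inequality costs the factor `1 /
-- mR` that turns `MR` into `MR / mR`.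
theorem IsDiagonalSemigroup.C1Relaxed_le_C1Lifting (h : IsDiagonalSemigroup S ev φ ψ mR MR ω)
    (hm : 0 < m) {ζ : ℝ} (hζ : ∀ n, dampingRatio (ev n) ≤ ζ) (E : Module.Basis (Fin m) K V)
    (B AB : V →L[K] H) :
    C1Relaxed (-ω) mR MR E B AB ev ψ ≤ C1Lifting (-ω) ζ mR MR E B AB := by
  have hζ0 : 0 ≤ ζ := le_trans (by unfold dampingRatio; positivity) (hζ 0)
  have hmR := h.riesz.lower_pos
  have hMR := h.riesz.upper_pos
  have h1 : ∀ k, ∑' n, relaxedTerm ev ψ B (E k) n ≤ ζ ^ 2 * (‖B (E k)‖ ^ 2 / mR) := fun k => by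
    refine ((h.summable_relaxedTerm_of_dampingRatio_le hζ B (E k)).tsum_le_tsum
      (relaxedTerm_le hζ B (E k))
      ((h.riesz.summable_coeff h.biorth (B (E k))).mul_left _)).trans ?_
    rw [tsum_mul_left]
    gcongr
    exact h.riesz.tsum_coeff_le h.biorth _
  have h2 : √(m * MR * ∑ k, ∑' n, relaxedTerm ev ψ B (E k) n)
      ≤ √(MR / mR) * (ζ * √(m * ∑ k, ‖B (E k)‖ ^ 2)) := by
    rw [← Real.sqrt_sq hζ0, ← Real.sqrt_mul (by positivity), ← Real.sqrt_mul (by positivity)]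
    refine Real.sqrt_le_sqrt ?_
    calc _ ≤ m * MR * ∑ k, ζ ^ 2 * (‖B (E k)‖ ^ 2 / mR) := by
          gcongr with k
          exact h1 k
      _ = _ := by
          rw [← Finset.mul_sum, ← Finset.sum_div]
          ring
  unfold C1Relaxed C1Lifting
  have hc := (basisConst_pos hm E).le
  calc _ ≤ 1 / -ω * √(MR / mR) * ‖AB‖
        + basisConst E * (√(MR / mR) * (ζ * √(m * ∑ k, ‖B (E k)‖ ^ 2))) := by gcongr
    _ = _ := by ring

omit [CompleteSpace H] in
-- Extending `E k ↦ Xe k` linearly gives a lifting with `𝒜B = 0`, so the lifting constant loses its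
-- `‖𝒜B‖` term.
theorem exists_isLifting_of_stationaryState (E : Module.Basis (Fin m) K V) {Xe : Fin m → H}
    (hXe : ∀ k, IsStationaryState A Bd (E k) (Xe k)) :
    ∃ B : V →L[K] H, IsLifting A Bd B 0 ∧ ∀ k, B (E k) = Xe k := by
  have : FiniteDimensional K V := E.finiteDimensional_of_finite
  refine ⟨LinearMap.toContinuousLinearMap (E.constr K Xe), ⟨fun v => ?_, fun v => ?_⟩,
    fun k => by simp⟩
  · have h1 : ((LinearMap.toContinuousLinearMap (E.constr K Xe)) v, (0 : V →L[K] H) v)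
        = ∑ k, E.equivFun v k • (Xe k, (0 : H)) := by
      refine Prod.ext ?_ ?_
      · simp [Module.Basis.constr_apply_fintype, Prod.fst_sum]
      · simp [Prod.snd_sum]
    rw [h1]
    exact Submodule.sum_mem _ fun k _ => Submodule.smul_mem _ _ (hXe k).1
  · have h1 : ((LinearMap.toContinuousLinearMap (E.constr K Xe)) v, v)
        = ∑ k, E.equivFun v k • (Xe k, E k) := by
      refine Prod.ext ?_ ?_
      · simp [Module.Basis.constr_apply_fintype, Prod.fst_sum]
      · simp only [Prod.snd_sum, Prod.smul_snd]
        exact (E.sum_equivFun v).symm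
    rw [h1]
    exact Submodule.sum_mem _ fun k _ => Submodule.smul_mem _ _ (hXe k).2

omit [CompleteSpace H] in
theorem C1Lifting_eq_C1Stationary (κ₀ ζ : ℝ) (E : Module.Basis (Fin m) K V) {Xe : Fin m → H}
    {B : V →L[K] H} (hB : ∀ k, B (E k) = Xe k) (h : 0 ≤ MR / mR) :
    C1Lifting κ₀ ζ mR MR E B 0 = C1Stationary ζ mR MR E Xe := by
  unfold C1Lifting C1Stationary
  simp only [hB]
  rw [mul_right_comm (m : ℝ), Real.sqrt_mul' _ h, norm_zero]
  ring

variable [NormedSpace ℝ H]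

theorem WeakExpISS.mono {κ₀ C₀ C₁ C₁' C₂ : ℝ} (h : WeakExpISS A Bd κ₀ C₀ C₁ C₂)
    (hC : C₁ ≤ C₁') : WeakExpISS A Bd κ₀ C₀ C₁' C₂ := by
  obtain ⟨h1, h2, h3, h4, h5⟩ := h
  refine ⟨h1, h2, h3.trans_le hC, h4, fun X₀ d U hd hU X hX t ht => ?_⟩
  refine (h5 X₀ d U hd hU X hX t ht).trans ?_
  have : 0 ≤ supNorm d t := (norm_nonneg _).trans (le_supNorm hd (left_mem_Icc.2 ht))
  gcongr

theorem IsDiagonalSemigroup.hasUniqueWeakSolutions [IsScalarTower ℝ K H]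
    (h : IsDiagonalSemigroup S ev φ ψ mR MR ω) (hω : ω < 0)
    (hA : IsGenerator S (disturbanceFree A Bd))
    (hev : ∀ n, (φ n, ev n • φ n) ∈ (disturbanceFree A Bd).graph) (hm : 0 < m)
    (E : Module.Basis (Fin m) K V) {B AB : V →L[K] H} (hB : IsLifting A Bd B AB)
    (hs : ∀ k, Summable (relaxedTerm ev ψ B (E k))) : HasUniqueWeakSolutions A Bd := by
  intro X₀ d U hd hU
  obtain ⟨X, hX, -⟩ := exists_weakSolution h hω hev hm E hB hs X₀ hd hU
  exact ⟨X, hX, fun Y hY => IsWeakSolution.eqOn h.riesz h.biorth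
    (h.mem_graph_adjoint hA (h.riesz.dense_domain hev)) ⟨B, AB, hB⟩ hX hY⟩

theorem IsDiagonalSemigroup.weakExpISS [IsScalarTower ℝ K H]
    (h : IsDiagonalSemigroup S ev φ ψ mR MR ω) (hω : ω < 0)
    (hA : IsGenerator S (disturbanceFree A Bd))
    (hev : ∀ n, (φ n, ev n • φ n) ∈ (disturbanceFree A Bd).graph) (hm : 0 < m)
    (E : Module.Basis (Fin m) K V) {B AB : V →L[K] H} (hB : IsLifting A Bd B AB)
    (hs : ∀ k, Summable (relaxedTerm ev ψ B (E k))) :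
    WeakExpISS A Bd (-ω) √(MR / mR) (C1Relaxed (-ω) mR MR E B AB ev ψ)
      (1 / (-ω) * √(MR / mR)) := by
  have hω' : 0 < -ω := neg_pos.2 hω
  have hC : 0 < √(MR / mR) := Real.sqrt_pos.2 (div_pos h.riesz.upper_pos h.riesz.lower_pos)
  refine ⟨hω', hC, h.C1Relaxed_pos hω hm E hB hs, by positivity,
    fun X₀ d U hd hU X hX t ht => ?_⟩
  obtain ⟨Y, hY, hYb⟩ := exists_weakSolution h hω hev hm E hB hs X₀ hd hU
  -- The bound is known for the constructed solution; uniqueness transfers it to any weak solution.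
  rw [IsWeakSolution.eqOn h.riesz h.biorth
    (h.mem_graph_adjoint hA (h.riesz.dense_domain hev)) ⟨B, AB, hB⟩ hY hX (mem_Ici.2 ht)]
  exact hYb t ht

end Main

end RieszBCS

end

/-! ### The main theorem. -/

open RieszBCS
theorem mainTheorem4 {K H V : Type*} [RCLike K]
    [NormedAddCommGroup H] [InnerProductSpace K H] [CompleteSpace H]
    [TopologicalSpace.SeparableSpace H] [NormedSpace ℝ H] [IsScalarTower ℝ K H]
    [NormedAddCommGroup V] [NormedSpace K V]
    (m : ℕ) (hm : 0 < m) (hV : Module.finrank K V = m)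
    (A : H →ₗ.[K] H) (Bd : H →ₗ.[K] V) (ev : ℕ → K) (φ : ℕ → H) (mR MR : ℝ)
    (hsys : IsRieszSpectralBCS A Bd ev φ mR MR)
    (ω₀ : ℝ) (hω₀ : IsLUB (Set.range fun n => RCLike.re (ev n)) ω₀) (hneg : ω₀ < 0) :
    -- `ω₀` is the growth bound of the semigroup generated by the disturbance free operator
    (∀ S : ℝ → H →L[K] H, IsC0Semigroup S → IsGenerator S (disturbanceFree A Bd) →
      IsGrowthBound S ω₀) ∧
    -- the biorthogonal sequence and the stationary solutions exist and are unique
    (∃! ψ : ℕ → H, IsBiorthogonal K φ ψ) ∧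
    (∀ e : V, ∃! x : H, IsStationaryState A Bd e x) ∧
    -- the case `ζ < ∞`
    (∀ ζ : ℝ, IsLUB (Set.range fun n => dampingRatio (ev n)) ζ →
      HasUniqueWeakSolutions A Bd ∧
      ∀ E : Module.Basis (Fin m) K V,
        (∀ B AB : V →L[K] H, IsLifting A Bd B AB →
          WeakExpISS A Bd (-ω₀) √(MR / mR) (C1Lifting (-ω₀) ζ mR MR E B AB)
            (1 / (-ω₀) * √(MR / mR))) ∧
        (∀ Xe : Fin m → H, (∀ k, IsStationaryState A Bd (E k) (Xe k)) →
          WeakExpISS A Bd (-ω₀) √(MR / mR) (C1Stationary ζ mR MR E Xe)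
            (1 / (-ω₀) * √(MR / mR)))) ∧
    -- the case of the relaxed summability condition
    (∀ ψ : ℕ → H, IsBiorthogonal K φ ψ → RelaxedDamping A Bd m ev ψ →
      HasUniqueWeakSolutions A Bd ∧
      ∀ (E : Module.Basis (Fin m) K V) (B AB : V →L[K] H), IsLifting A Bd B AB →
        (∀ k, Summable (relaxedTerm ev ψ B (E k))) ∧
        WeakExpISS A Bd (-ω₀) √(MR / mR) (C1Relaxed (-ω₀) mR MR E B AB ev ψ)
          (1 / (-ω₀) * √(MR / mR))) := by
  obtain ⟨S, hS, hG⟩ := hsys.bcs.generator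
  obtain ⟨B₀, AB₀, hB₀⟩ := hsys.bcs.lifting
  have hφ := hsys.spectral.riesz
  have hev := hsys.spectral.eigen
  have hre : ∀ n, RCLike.re (ev n) ≤ ω₀ := fun n => hω₀.1 ⟨n, rfl⟩
  obtain ⟨ψ₀, hψ₀⟩ := hφ.exists_biorthogonal
  have hD := hS.isDiagonalSemigroup hG hφ hψ₀ hev hre
  refine ⟨fun S' hS' hG' => (hS'.isDiagonalSemigroup hG' hφ hψ₀ hev hre).isGrowthBound hω₀,
    ⟨ψ₀, hψ₀, fun ψ hψ => hφ.biorthogonal_unique hψ₀ hψ⟩,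
    hD.existsUnique_stationaryState hneg hG hsys.spectral.closed hev hB₀, ?_, ?_⟩
  · intro ζ hζ
    have hζn : ∀ n, dampingRatio (ev n) ≤ ζ := fun n => hζ.1 ⟨n, rfl⟩
    have hsum : ∀ (B : V →L[K] H) (v : V), Summable (relaxedTerm ev ψ₀ B v) :=
      hD.summable_relaxedTerm_of_dampingRatio_le hζn
    have hfin : FiniteDimensional K V := Module.finite_of_finrank_pos (hV ▸ hm)
    have hiss : ∀ (E : Module.Basis (Fin m) K V) (B AB : V →L[K] H), IsLifting A Bd B AB →
        WeakExpISS A Bd (-ω₀) √(MR / mR) (C1Lifting (-ω₀) ζ mR MR E B AB)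
          (1 / (-ω₀) * √(MR / mR)) := fun E B AB hB =>
      (hD.weakExpISS hneg hG hev hm E hB fun k => hsum B _).mono
        (hD.C1Relaxed_le_C1Lifting hm hζn E B AB)
    refine ⟨hD.hasUniqueWeakSolutions hneg hG hev hm (Module.finBasisOfFinrankEq K V hV) hB₀
      fun k => hsum B₀ _, fun E => ⟨hiss E, fun Xe hXe => ?_⟩⟩
    obtain ⟨B, hB, hBE⟩ := exists_isLifting_of_stationaryState E hXe
    rw [← C1Lifting_eq_C1Stationary (-ω₀) ζ E hBE
      (div_pos hφ.upper_pos hφ.lower_pos).le]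
    exact hiss E B 0 hB
  · intro ψ hψ hR
    have hD := hS.isDiagonalSemigroup hG hφ hψ hev hre
    have hsum : ∀ {B AB : V →L[K] H}, IsLifting A Bd B AB → ∀ v,
        Summable (relaxedTerm ev ψ B v) := hD.summable_relaxedTerm hneg hG hR
    refine ⟨?_, fun E B AB hB => ⟨fun k => hsum hB _,
      hD.weakExpISS hneg hG hev hm E hB fun k => hsum hB _⟩⟩
    obtain ⟨B, AB, hB, E, hE⟩ := hR
    exact hD.hasUniqueWeakSolutions hneg hG hev hm E hB hE
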